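/- Let $\Gamma$ be a locally finite tree with root $\rho$, either infinite and without leaves (height $N=\infty$) or finite with all maximal paths from the root of the same length $N<\infty$; write $|\sigma|$ for the distance from $\rho$ to a vertex $\sigma$, and $\tau\le\sigma$ if $\tau$ lies on the path from $\rho$ to $\sigma$. The boundary $\partial\Gamma$ is the set of rays, i.e. of maximal paths starting at $\rho$, and $|\xi\wedge\eta|\in\{0,1,\dots,\infty\}$ denotes the level of the last common vertex of two rays (so for $N=\infty$ it is $\infty$ when $\xi=\eta$). Assume that $\Gamma$ is spherically symmetric: the number of children of a vertex depends only on its distance from $\rho$. Let $(X(\sigma))_{\sigma\ne\rho}$ be i.i.d. real random variables and let $B\subseteq\mathbb R^N$ be a closed set (for $N=\infty$, closed in the product topology of $\mathbb R^{\{1,2,\dots\}}$). The target percolation with target set $B$ is the random vertex set $W$ that contains $\rho$ and contains a vertex $\sigma\neq\rho$, with path $\rho,\tau_1,\dots,\tau_k=\sigma$ from the root, if and only if $(X(\tau_1),\dots,X(\tau_k))\in\pi_kB$, where $\pi_k$ is the projection onto the first $k$ coordinates. Let $\{\rho\leftrightarrow\sigma\}$ be the event that $W$ contains the path from $\rho$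 to $\sigma$, and $\{\rho\leftrightarrow\partial\Gamma\}$ the event that $W$ contains a ray. Then $\mathbf P(\rho\leftrightarrow\sigma)$ depends only on $|\sigma|$, say $\mathbf P(\rho\leftrightarrow\sigma)=p(|\sigma|)$, and $$\mathbf P(\rho\leftrightarrow\partial\Gamma)>0\quad\Longrightarrow\quad \mathrm{Cap}_p(\Gamma)>0 ,$$ where $\mathrm{Cap}_p(\Gamma)^{-1}=\inf_\mu\int_{\partial\Gamma}\int_{\partial\Gamma}p(|\xi\wedge\eta|)^{-1}\,d\mu(\xi)\,d\mu(\eta)$, the infimum is over Borel probability measures $\mu$ on $\partial\Gamma$, and, when $N=\infty$, $p(\infty)=\lim_{n\to\infty}p(n)$. -/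

import Mathlib

open MeasureTheory ProbabilityTheory
open scoped ENNReal

namespace TreePercolation

variable {V : Type*}

/-- `|σ|`: the distance from the root `ρ` to the vertex `σ`. -/
noncomputable def level (G : SimpleGraph V) (ρ σ : V) : ℕ := G.dist ρ σ

/-- The children of `σ`: its neighbours that are one step further away from the root. -/
def children (G : SimpleGraph V) (ρ σ : V) : Set V :=
  {τ | G.Adj σ τ ∧ level G ρ τ = level G ρ σ + 1}

/-- `τ ≤ σ`: the vertex `τ` lies on the path connecting the root `ρ` to `σ`. -/
def OnPathTo (G : SimpleGraph V) (ρ τ σ : V) : Prop :=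
  ∃ w : G.Walk ρ σ, w.IsPath ∧ τ ∈ w.support

/-- `G` is a locally finite tree, rooted at `ρ`, of constant height `N ≤ ∞`: for `N = ∞` an
infinite tree without leaves, for `N < ∞` a finite tree all of whose maximal paths from the root
have length `N`. -/
structure IsRootedTree (G : SimpleGraph V) (ρ : V) (N : ℕ∞) : Prop where
  isTree : G.IsTree
  locallyFinite : ∀ σ, (G.neighborSet σ).Finite
  level_le : ∀ σ, (level G ρ σ : ℕ∞) ≤ N
  children_nonempty : ∀ σ, (level G ρ σ : ℕ∞) < N → (children G ρ σ).Nonempty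

/-- Spherical symmetry: the number of children of a vertex depends only on its level. -/
def IsSphericallySymmetric (G : SimpleGraph V) (ρ : V) : Prop :=
  ∃ f : ℕ → ℕ, ∀ σ, (children G ρ σ).encard = f (level G ρ σ)

/-- The boundary: the set of rays, i.e. paths `(ξ k)`, `0 ≤ k ≤ N`, `k` finite, that start at the
root and move one level away from it in each step. (`level = 0` only at the root of a tree.) -/
def Boundary (G : SimpleGraph V) (ρ : V) (N : ℕ∞) : Type _ :=
  {ξ : {k : ℕ // (k : ℕ∞) ≤ N} → V //
    (∀ k, level G ρ (ξ k) = (k : ℕ)) ∧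
    ∀ k l : {k : ℕ // (k : ℕ∞) ≤ N}, (l : ℕ) = (k : ℕ) + 1 → G.Adj (ξ k) (ξ l)}

/-- The σ-algebra on the boundary generated by the vertices of the ray. On a locally finite tree
it is the Borel σ-algebra of the metric `exp (-|ξ ∧ η|)`. -/
instance Boundary.measurableSpace (G : SimpleGraph V) (ρ : V) (N : ℕ∞) :
    MeasurableSpace (Boundary G ρ N) :=
  ⨆ k : {k : ℕ // (k : ℕ∞) ≤ N}, MeasurableSpace.comap (fun ξ : Boundary G ρ N => ξ.1 k) ⊤

/-- `|ξ ∧ η|`: the level of the last common vertex of two rays (`⊤` if the rays are infinite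
and equal). -/
noncomputable def meetLevel {G : SimpleGraph V} {ρ : V} {N : ℕ∞} (ξ η : Boundary G ρ N) : ℕ∞ :=
  ⨆ (k : {k : ℕ // (k : ℕ∞) ≤ N}) (_ : ξ.1 k = η.1 k), ((k : ℕ) : ℕ∞)

/-- A gauge extended to level `∞`; for a nonincreasing `φ` the value at `⊤` is `lim φ n`. -/
noncomputable def extendGauge (φ : ℕ → ℝ≥0∞) : ℕ∞ → ℝ≥0∞
  | (n : ℕ) => φ n
  | ⊤ => ⨅ n, φ n

/-- The energy `I_φ(μ) = ∫∫ φ(|ξ ∧ η|)⁻¹ dμ(ξ) dμ(η)`. -/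
noncomputable def energy {G : SimpleGraph V} {ρ : V} {N : ℕ∞} (φ : ℕ → ℝ≥0∞)
    (μ : Measure (Boundary G ρ N)) : ℝ≥0∞ :=
  ∫⁻ ξ, ∫⁻ η, (extendGauge φ (meetLevel ξ η))⁻¹ ∂μ ∂μ

/-- The capacity: `1 / Cap_φ` is the infimum of the energies of probability measures on the
boundary. -/
noncomputable def capacity (G : SimpleGraph V) (ρ : V) (N : ℕ∞) (φ : ℕ → ℝ≥0∞) : ℝ≥0∞ :=
  (⨅ (μ : Measure (Boundary G ρ N)) (_ : IsProbabilityMeasure μ), energy φ μ)⁻¹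

/-- The random vertex set `W` of the target percolation with target set `B ⊆ ℝ^N`, as a function
of the values `x σ`, `σ ≠ ρ`. Coordinates of `ℝ^N` are numbered from `0`, so coordinate `j`
belongs to the vertex at level `j + 1`. A vertex `σ ≠ ρ` with path `ρ, τ₁, …, τ_k = σ` is in `W`
iff `(x τ₁, …, x τ_k)` is the restriction to the first `k` coordinates of some `b ∈ B`. -/
def targetPercolation (G : SimpleGraph V) (ρ : V) {N : ℕ∞}
    (B : Set ({j : ℕ // (j : ℕ∞) < N} → ℝ)) (x : V → ℝ) : Set V :=
  {σ | σ = ρ ∨ ∃ b ∈ B, ∀ (j : {j : ℕ // (j : ℕ∞) < N}) (τ : V),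
    OnPathTo G ρ τ σ → level G ρ τ = (j : ℕ) + 1 → x τ = b j}

/-- `ρ ↔ σ` in `W`: the set `W` contains the path from `ρ` to `σ`. -/
def ConnectsTo (G : SimpleGraph V) (ρ : V) (W : Set V) (σ : V) : Prop :=
  ∀ τ, OnPathTo G ρ τ σ → τ ∈ W

/-- `ρ ↔ ∂Γ` in `W`: the set `W` contains a ray. -/
def ReachesBoundary (G : SimpleGraph V) (ρ : V) (N : ℕ∞) (W : Set V) : Prop :=
  ∃ ξ : Boundary G ρ N, ∀ k, ξ.1 k ∈ W

end TreePercolation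

namespace TreePercolation

/-! Spherical symmetry suggests one test measure, the uniform measure on the boundary. With `f i`
children at level `i` and `M k = ∏ i < k, f i` vertices at level `k`, telescoping `1 / p` along the
common part of two rays bounds its energy by the supremum over `n ≤ N` of `E n = 1 / p 0 + ∑ k < n,
(1 / p (k+1) - 1 / p k) / M (k+1)`. The core is the quantitative bound that `W` reaches level `n`
with probability at most `2 / E n` (`measure_exists_chain_le`). If the survival probability is `Q >
0`, then every `E n` is at most `2 / Q`, hence so is the energy.

The chance of reaching level `n` from a vertex at level `k` depends on all labels `z` on the path to
it, so no scalar recursion is available. `measure_reaches_le` bounds it by `K k` times the sum over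
`j ≥ k` of `w j` times the conditional probability, given `z`, that a path stays in the target at
level `j`. Such a linear expression survives averaging over the next label, so only the branching
map `q ↦ 1 - (1 - q) ^ f` needs an affine majorant. `one_sub_one_sub_pow_le` gives one for every
parameter `R > 0`: with `y = f q` and `c = (1 - 1/f) / 2` the map is at most the concave function `y
/ (1 + c y)`, hence at most its tangent at `y = 1 / R`. `exists_weights` chooses `R` at each level
so that slopes and intercepts fit together; at the root the bound collapses to at most `2 / E n`.

The projections of a closed set are analytic but need not be Borel. Capacitability
(`nullMeasurableSet_of_analyticSet`) makes their probabilities computable, and the upper bound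
replaces them by measurable hulls. -/

/-! ### Capacitability: analytic sets are universally measurable. -/

theorem isCompact_setOf_forall_le (n : ℕ → ℕ) : IsCompact {x : ℕ → ℕ | ∀ i, x i ≤ n i} := by
  have : {x : ℕ → ℕ | ∀ i, x i ≤ n i} = Set.univ.pi (fun i => Set.Iic (n i)) := by
    ext; simp [Pi.le_def]
  rw [this]
  exact isCompact_univ_pi fun i => (Set.finite_Iic (n i)).isCompact

open Filter Topology in
/-- A tube lemma for boxes in the Baire space: an open set that contains the compact box of all
sequences dominated by `n` contains a box with finitely many constraints. -/
theorem exists_box_subset_of_isOpen {O : Set (ℕ → ℕ)} (hO : IsOpen O) (n : ℕ → ℕ)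
    (h : {x : ℕ → ℕ | ∀ i, x i ≤ n i} ⊆ O) : ∃ k, {x : ℕ → ℕ | ∀ i < k, x i ≤ n i} ⊆ O := by
  by_contra! hcon
  have hcon' : ∀ k, ∃ x : ℕ → ℕ, (∀ i < k, x i ≤ n i) ∧ x ∉ O := by
    intro k
    obtain ⟨x, hx, hxO⟩ := Set.not_subset.1 (hcon k)
    exact ⟨x, hx, hxO⟩
  choose x hx hxO using hcon'
  have hK := isCompact_setOf_forall_le n
  -- Cutting `x k` off after its `k` controlled coordinates puts it in the compact box.
  -- Coordinatewise limits do not notice the cut.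
  let y : ℕ → ℕ → ℕ := fun k i => if i < k then x k i else 0
  have hy : ∀ k, y k ∈ {x : ℕ → ℕ | ∀ i, x i ≤ n i} := by
    intro k i
    by_cases hi : i < k
    · simpa [y, hi] using hx k i hi
    · simp [y, hi]
  obtain ⟨a, ha, φ, hφ, hlim⟩ := hK.tendsto_subseq hy
  have hlim' : Tendsto (fun k => x (φ k)) atTop (𝓝 a) := by
    rw [tendsto_pi_nhds] at hlim ⊢
    intro i
    refine (hlim i).congr' ?_
    filter_upwards [eventually_gt_atTop i] with k hk
    have : i < φ k := lt_of_lt_of_le hk (hφ.id_le k)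
    simp [y, this]
  have := hlim'.eventually (hO.mem_nhds (h ha))
  obtain ⟨k, hk⟩ := this.exists
  exact hxO _ hk

/-- Inner approximation of an analytic set by compact sets. -/
theorem exists_isCompact_measure_ge_of_analyticSet {α : Type*} [TopologicalSpace α]
    [MeasurableSpace α] {μ : Measure α} [μ.OuterRegular]
    {A : Set α} (hA : AnalyticSet A) {c : ℝ≥0∞} (hc : c < μ A) :
    ∃ K ⊆ A, IsCompact K ∧ c ≤ μ K := by
  rw [AnalyticSet] at hA
  rcases hA with rfl | ⟨f, hf, rfl⟩
  · simp at hc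
  let box : (ℕ → ℕ) → ℕ → Set (ℕ → ℕ) := fun n k => {x | ∀ i < k, x i ≤ n i}
  -- One coordinate is bounded at a time: the images increase with the bound `m`, and continuity
  -- from below, valid for arbitrary sets, keeps the measure above `c`.
  have step : ∀ (k : ℕ) (n : ℕ → ℕ), c < μ (f '' box n k) →
      ∃ m, c < μ (f '' box (Function.update n k m) (k + 1)) := by
    intro k n h
    have hU : f '' box n k = ⋃ m, f '' box (Function.update n k m) (k + 1) := by
      rw [← Set.image_iUnion]
      congr 1
      ext x
      simp only [box, Set.mem_ofPred_eq, Set.mem_iUnion]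
      constructor
      · intro hx
        refine ⟨x k, fun i hi => ?_⟩
        rcases Nat.lt_succ_iff_lt_or_eq.1 hi with hi | rfl
        · rw [Function.update_of_ne hi.ne]; exact hx i hi
        · simp
      · rintro ⟨m, hm⟩ i hi
        have := hm i (by omega)
        rwa [Function.update_of_ne hi.ne] at this
    rw [hU, Monotone.measure_iUnion] at h
    · exact lt_iSup_iff.1 h
    · intro a b hab
      apply Set.image_mono
      intro x hx i hi
      refine (hx i hi).trans ?_
      rcases eq_or_ne i k with rfl | hik
      · simpa using hab
      · simp [Function.update_of_ne hik]
  choose! g hg using step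
  let N : ℕ → ℕ → ℕ := fun k => Nat.rec (fun _ => 0) (fun k n => Function.update n k (g k n)) k
  have hN : ∀ k, c < μ (f '' box (N k) k) := by
    intro k
    induction k with
    | zero =>
      have : box (N 0) 0 = Set.univ := by ext; simp [box]
      rwa [this, Set.image_univ]
    | succ k ih => exact hg k (N k) ih
  let n : ℕ → ℕ := fun i => N (i + 1) i
  have hNn : ∀ k i, i < k → N k i = n i := by
    intro k
    induction k with
    | zero => intro i hi; omega
    | succ k ih =>
      intro i hi
      rcases Nat.lt_succ_iff_lt_or_eq.1 hi with hi | rfl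
      · rw [← ih i hi]
        exact Function.update_of_ne hi.ne _ _
      · rfl
  have hbox : ∀ k, box (N k) k = box n k := by
    intro k
    ext x
    exact forall₂_congr fun i hi => by rw [hNn k i hi]
  have hK := isCompact_setOf_forall_le n
  refine ⟨f '' {x | ∀ i, x i ≤ n i}, Set.image_subset_range _ _, hK.image hf, ?_⟩
  -- The measure of the compact image is tested on open supersets; each already contains the image
  -- of a box with finitely many constraints, whose measure exceeds `c`.
  rw [Set.measure_eq_iInf_isOpen]
  refine le_iInf₂ fun U hU => le_iInf fun hUo => ?_
  obtain ⟨k, hk⟩ := exists_box_subset_of_isOpen (hUo.preimage hf) n (Set.image_subset_iff.1 hU)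
  refine (hN k).le.trans (measure_mono ?_)
  rw [hbox k]
  exact Set.image_subset_iff.2 hk

/-- Analytic sets are universally measurable. -/
theorem nullMeasurableSet_of_analyticSet {α : Type*} [TopologicalSpace α] [T2Space α]
    [MeasurableSpace α] [OpensMeasurableSpace α] {μ : Measure α} [IsFiniteMeasure μ]
    [μ.OuterRegular] {A : Set α} (hA : AnalyticSet A) : NullMeasurableSet A μ := by
  by_cases h0 : μ A = 0
  · exact NullMeasurableSet.of_null h0
  obtain ⟨u, -, hu, hulim⟩ := exists_seq_strictMono_tendsto' (pos_iff_ne_zero.2 h0)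
  choose K hKA hK hKc using fun i => exists_isCompact_measure_ge_of_analyticSet hA (hu i).2
  have hm : MeasurableSet (⋃ i, K i) := MeasurableSet.iUnion fun i => (hK i).measurableSet
  have hsub : ⋃ i, K i ⊆ A := Set.iUnion_subset hKA
  have hle : μ A ≤ μ (⋃ i, K i) :=
    le_of_tendsto' hulim fun i => (hKc i).trans (measure_mono (Set.subset_iUnion K i))
  have hae : (⋃ i, K i : Set α) =ᵐ[μ] toMeasurable μ A :=
    ae_eq_of_subset_of_measure_ge (hsub.trans (subset_toMeasurable μ A))
      (by rwa [measure_toMeasurable]) hm.nullMeasurableSet (measure_ne_top _ _)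
  refine (measurableSet_toMeasurable μ A).nullMeasurableSet.congr ?_
  refine (Filter.EventuallyLE.antisymm ?_ ?_)
  · exact hae.symm.le.trans hsub.eventuallyLE
  · exact (subset_toMeasurable μ A).eventuallyLE

/-! ### Independence of events carried by disjoint sets of labels. -/

section Independence

variable {Ω I : Type*} [MeasurableSpace Ω] {P : Measure Ω} {X : I → Ω → ℝ}

theorem measurable_extend_zero (S : Finset I) [DecidablePred (· ∈ S)] :
    Measurable (fun (y : S → ℝ) (i : I) => if h : i ∈ S then y ⟨i, h⟩ else 0) := by
  refine measurable_pi_lambda _ fun i => ?_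
  by_cases h : i ∈ S
  · simpa [h] using measurable_pi_apply _
  · simp [h]

/-- Events that depend on disjoint finite sets of independent labels are independent. -/
theorem measure_inter_eq_mul_of_dependsOn (hX : iIndepFun X P) (hXm : ∀ i, Measurable (X i))
    {S T : Finset I} (hST : Disjoint S T) {F G : Set (I → ℝ)} (hF : MeasurableSet F)
    (hG : MeasurableSet G) (hFS : DependsOn (· ∈ F) (S : Set I))
    (hGT : DependsOn (· ∈ G) (T : Set I)) :
    P {ω | (fun i => X i ω) ∈ F ∧ (fun i => X i ω) ∈ G} =
      P {ω | (fun i => X i ω) ∈ F} * P {ω | (fun i => X i ω) ∈ G} := by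
  classical
  have key : ∀ (U : Finset I) (H : Set (I → ℝ)), DependsOn (· ∈ H) (U : Set I) →
      {ω | (fun i => X i ω) ∈ H} = (fun ω (i : U) => X i ω) ⁻¹'
        ((fun (y : U → ℝ) (i : I) => if h : i ∈ U then y ⟨i, h⟩ else 0) ⁻¹' H) := by
    intro U H hH
    ext ω
    refine iff_of_eq (hH fun i hi => ?_)
    have : i ∈ U := hi
    simp [this]
  have := (hX.indepFun_finset S T hST hXm).measure_inter_preimage_eq_mul _ _
    (measurable_extend_zero S hF) (measurable_extend_zero T hG)
  rw [← key S F hFS, ← key T G hGT] at this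
  exact this

/-- Events that depend on a label and on a disjoint finite set of labels are computed by
Fubini's theorem. -/
theorem measure_eq_lintegral_of_dependsOn [IsProbabilityMeasure P] (hX : iIndepFun X P)
    (hXm : ∀ i, Measurable (X i)) {S : Finset I} {τ : I} (hτ : τ ∉ S) {Φ : Set (ℝ × (I → ℝ))}
    (hΦ : MeasurableSet Φ) (hΦS : ∀ y, DependsOn (fun x => (y, x) ∈ Φ) (S : Set I)) :
    P {ω | (X τ ω, fun i => X i ω) ∈ Φ} =
      ∫⁻ y, P {ω | (y, fun i => X i ω) ∈ Φ} ∂(P.map (X τ)) := by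
  classical
  let e : (S → ℝ) → I → ℝ := fun y i => if h : i ∈ S then y ⟨i, h⟩ else 0
  have he : Measurable e := measurable_extend_zero S
  let Y : Ω → I → ℝ := fun ω => e (fun i : S => X i ω)
  have hYm : Measurable Y := he.comp (measurable_pi_lambda _ fun i => hXm i)
  have hYX : ∀ (y : ℝ) (ω : Ω), ((y, fun i => X i ω) ∈ Φ) ↔ (y, Y ω) ∈ Φ := by
    intro y ω
    refine iff_of_eq (hΦS y fun i hi => ?_)
    have : i ∈ S := hi
    simp [Y, e, this]
  have hind : IndepFun (X τ) Y P := by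
    have := hX.indepFun_finset {τ} S (Finset.disjoint_singleton_left.2 hτ) hXm
    have hev : Measurable fun y : ({τ} : Finset I) → ℝ => y ⟨τ, Finset.mem_singleton_self τ⟩ :=
      measurable_pi_apply _
    exact this.comp hev he
  have hlaw := (indepFun_iff_map_prod_eq_prod_map_map (hXm τ).aemeasurable hYm.aemeasurable).1 hind
  have := Measure.isProbabilityMeasure_map (μ := P) hYm.aemeasurable
  calc P {ω | (X τ ω, fun i => X i ω) ∈ Φ} = P ((fun ω => (X τ ω, Y ω)) ⁻¹' Φ) := by
        congr 1; ext ω; exact hYX _ ω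
    _ = (P.map (fun ω => (X τ ω, Y ω))) Φ := (Measure.map_apply ((hXm τ).prodMk hYm) hΦ).symm
    _ = ∫⁻ y, P.map Y (Prod.mk y ⁻¹' Φ) ∂(P.map (X τ)) := by rw [hlaw, Measure.prod_apply hΦ]
    _ = _ := by
        refine lintegral_congr fun y => ?_
        rw [Measure.map_apply hYm (measurable_prodMk_left hΦ)]
        congr 1; ext ω; exact (hYX y ω).symm

/-- The probability of a union of independent events. -/
theorem measure_exists_le_of_dependsOn [IsProbabilityMeasure P] (hX : iIndepFun X P)
    (hXm : ∀ i, Measurable (X i)) {J : Type*} (s : Finset J) (S : J → Finset I)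
    (hS : (s : Set J).PairwiseDisjoint S) (E : J → Set (I → ℝ)) (hE : ∀ j, MeasurableSet (E j))
    (hES : ∀ j, DependsOn (· ∈ E j) (S j : Set I)) {Q : ℝ≥0∞}
    (hQ : ∀ j ∈ s, P {ω | (fun i => X i ω) ∈ E j} ≤ Q) :
    P {ω | ∃ j ∈ s, (fun i => X i ω) ∈ E j} ≤ 1 - (1 - Q) ^ s.card := by
  classical
  have hXm' : Measurable (fun ω i => X i ω) := measurable_pi_lambda _ hXm
  have hmeas : ∀ t : Finset J, MeasurableSet {x : I → ℝ | ∀ j ∈ t, x ∉ E j} := by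
    intro t
    have : {x : I → ℝ | ∀ j ∈ t, x ∉ E j} = ⋂ j ∈ t, (E j)ᶜ := by ext; simp
    rw [this]
    exact Finset.measurableSet_biInter _ fun j _ => (hE j).compl
  have key : ∀ t ⊆ s, (1 - Q) ^ t.card ≤ P {ω | ∀ j ∈ t, (fun i => X i ω) ∉ E j} := by
    intro t
    induction t using Finset.induction_on with
    | empty => simp
    | insert a t ha ih =>
      intro hts
      have hat : a ∈ s := hts (Finset.mem_insert_self a t)
      have hts' : t ⊆ s := (Finset.subset_insert a t).trans hts
      have hdisj : Disjoint (S a) (t.biUnion S) := by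
        rw [Finset.disjoint_biUnion_right]
        exact fun j hj => hS hat (hts' hj) (fun h => ha (h ▸ hj))
      have hmul := measure_inter_eq_mul_of_dependsOn (P := P) hX hXm hdisj
        (F := (E a)ᶜ) (G := {x | ∀ j ∈ t, x ∉ E j}) (hE a).compl (hmeas t)
        (fun x y hxy => by
          have : x ∈ E a ↔ y ∈ E a := iff_of_eq (hES a hxy)
          simp [this])
        (fun x y hxy => by
          simp only [Set.mem_ofPred_eq, eq_iff_iff]
          refine forall₂_congr fun j hj => not_congr (iff_of_eq (hES j fun i hi => hxy i ?_))
          exact Finset.mem_biUnion.2 ⟨j, hj, hi⟩)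
      have hset : {ω | ∀ j ∈ insert a t, (fun i => X i ω) ∉ E j} =
          {ω | (fun i => X i ω) ∈ (E a)ᶜ ∧ (fun i => X i ω) ∈ {x : I → ℝ | ∀ j ∈ t, x ∉ E j}} := by
        ext ω; simp
      rw [hset, hmul, Finset.card_insert_of_notMem ha, pow_succ']
      refine mul_le_mul' ?_ (ih hts')
      have : {ω | (fun i => X i ω) ∈ (E a)ᶜ} = {ω | (fun i => X i ω) ∈ E a}ᶜ := rfl
      rw [this, prob_compl_eq_one_sub (show MeasurableSet {ω | (fun i => X i ω) ∈ E a} from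
        hXm' (hE a))]
      exact tsub_le_tsub_left (hQ a hat) 1
  have hcompl : {ω | ∃ j ∈ s, (fun i => X i ω) ∈ E j} =
      {ω | ∀ j ∈ s, (fun i => X i ω) ∉ E j}ᶜ := by
    ext ω; simp
  rw [hcompl, prob_compl_eq_one_sub
    (show MeasurableSet {ω | ∀ j ∈ s, (fun i => X i ω) ∉ E j} from hXm' (hmeas s))]
  exact tsub_le_tsub_left (key s subset_rfl) 1

end Independence

/-! ### Backward induction on the level. -/

section Reaches

variable {V I : Type*}

/-- A vertex `σ` at level `k`, reached with the labels `z 0, …, z (k - 1)`, has a descendant `m`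
levels below it along the path to which the sequence of labels stays in the sets `A j`. -/
def Reaches (v : I → V) (ch : V → Finset I) (A : ℕ → Set (ℕ → ℝ)) :
    ℕ → ℕ → V → (ℕ → ℝ) → (I → ℝ) → Prop
  | 0, k, _, z, _ => z ∈ A k
  | m + 1, k, σ, z, x => z ∈ A k ∧
      ∃ τ ∈ ch σ, Reaches v ch A m (k + 1) (v τ) (Function.update z k (x τ)) x

open Classical in
/-- The proper descendants of `σ` in the first `m` levels below it. -/
noncomputable def descendants (v : I → V) (ch : V → Finset I) : ℕ → V → Finset I
  | 0, _ => ∅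
  | m + 1, σ => (ch σ).biUnion fun τ => insert τ (descendants v ch m (v τ))

variable {v : I → V} {ch : V → Finset I} {A : ℕ → Set (ℕ → ℝ)}

theorem measurableSet_reaches (hA : ∀ j, MeasurableSet (A j)) (m k : ℕ) (σ : V) :
    MeasurableSet {p : (ℕ → ℝ) × (I → ℝ) | Reaches v ch A m k σ p.1 p.2} := by
  induction m generalizing k σ with
  | zero => exact measurable_fst (hA k)
  | succ m ih =>
    have : {p : (ℕ → ℝ) × (I → ℝ) | Reaches v ch A (m + 1) k σ p.1 p.2} =
        (Prod.fst ⁻¹' A k) ∩ ⋃ τ ∈ ch σ, (fun p : (ℕ → ℝ) × (I → ℝ) =>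
          (Function.update p.1 k (p.2 τ), p.2)) ⁻¹'
            {p | Reaches v ch A m (k + 1) (v τ) p.1 p.2} := by
      ext p; simp [Reaches]
    rw [this]
    refine (measurable_fst (hA k)).inter (Finset.measurableSet_biUnion _ fun τ _ => ?_)
    refine Measurable.prodMk ?_ measurable_snd (ih _ _)
    refine measurable_pi_lambda _ fun i => ?_
    rcases eq_or_ne i k with rfl | hi
    · simpa using measurable_snd.eval
    · simpa [Function.update_of_ne hi] using measurable_fst.eval

theorem dependsOn_reaches (m k : ℕ) (σ : V) (z : ℕ → ℝ) :
    DependsOn (Reaches v ch A m k σ z) (descendants v ch m σ : Set I) := by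
  classical
  induction m generalizing k σ z with
  | zero => intro x y _; rfl
  | succ m ih =>
    intro x y hxy
    simp only [Reaches, eq_iff_iff]
    refine and_congr_right fun _ => exists_congr fun τ => and_congr_right fun hτ => ?_
    have hmem : ∀ i ∈ insert τ (descendants v ch m (v τ)), x i = y i := fun i hi =>
      hxy i (Finset.mem_biUnion.2 ⟨τ, hτ, hi⟩)
    rw [hmem τ (Finset.mem_insert_self _ _)]
    exact iff_of_eq (ih _ _ _ fun i hi => hmem i (Finset.mem_insert_of_mem hi))

variable {par : I → V} {lvl : V → ℕ}

/-- The relation `par a = v b` says that `b` is the parent of `a`; its reflexive transitive closure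
climbs from a descendant to an ancestor. -/
theorem reflTransGen_of_mem_descendants (hpar : ∀ σ, ∀ i ∈ ch σ, par i = σ) (m : ℕ) (τ i : I)
    (hi : i ∈ descendants v ch m (v τ)) :
    ∃ j, par j = v τ ∧ Relation.ReflTransGen (fun a b => par a = v b) i j := by
  classical
  induction m generalizing τ with
  | zero => simp [descendants] at hi
  | succ m ih =>
    obtain ⟨j, hj, hij⟩ := Finset.mem_biUnion.1 hi
    refine ⟨j, hpar _ _ hj, ?_⟩
    rcases Finset.mem_insert.1 hij with rfl | hij
    · exact .refl
    · obtain ⟨l, hl, hil⟩ := ih j hij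
      exact hil.tail hl

theorem level_le_of_reflTransGen (hlvl : ∀ i, lvl (v i) = lvl (par i) + 1) {i j : I}
    (h : Relation.ReflTransGen (fun a b => par a = v b) i j) :
    i = j ∨ lvl (v j) < lvl (v i) := by
  induction h with
  | refl => exact .inl rfl
  | @tail b c _ hbc ih =>
    right
    have : lvl (v c) < lvl (v b) := by rw [hlvl b, hbc]; omega
    rcases ih with rfl | ih
    · exact this
    · exact this.trans ih

theorem notMem_descendants (hpar : ∀ σ, ∀ i ∈ ch σ, par i = σ)
    (hlvl : ∀ i, lvl (v i) = lvl (par i) + 1) (m : ℕ) (τ : I) :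
    τ ∉ descendants v ch m (v τ) := by
  intro h
  obtain ⟨j, hj, hij⟩ := reflTransGen_of_mem_descendants hpar m τ τ h
  have := level_le_of_reflTransGen hlvl (hij.tail hj)
  have h2 := level_le_of_reflTransGen hlvl hij
  have h3 := hlvl j
  rw [hj] at h3
  rcases h2 with rfl | h2 <;> omega

/-- Parents are unique, so two ancestors of one vertex are comparable; siblings lie on the same
level, so comparable siblings coincide. -/
theorem pairwiseDisjoint_descendants [DecidableEq I] (hv : Function.Injective v)
    (hpar : ∀ σ, ∀ i ∈ ch σ, par i = σ)
    (hlvl : ∀ i, lvl (v i) = lvl (par i) + 1) (m : ℕ) (σ : V) :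
    (ch σ : Set I).PairwiseDisjoint fun τ => insert τ (descendants v ch m (v τ)) := by
  have up : ∀ τ i, i ∈ insert τ (descendants v ch m (v τ)) →
      Relation.ReflTransGen (fun a b => par a = v b) i τ := by
    intro τ i hi
    rcases Finset.mem_insert.1 hi with rfl | hi
    · exact .refl
    · obtain ⟨j, hj, hij⟩ := reflTransGen_of_mem_descendants hpar m τ i hi
      exact hij.tail hj
  intro τ hτ τ' hτ' hne
  rw [Function.onFun, Finset.disjoint_left]
  intro i hi hi'
  have huniq : Relator.RightUnique (fun a b => par a = v b) :=
    fun a b c hb hc => hv (hb.symm.trans hc)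
  have hl : lvl (v τ) = lvl (v τ') := by
    rw [hlvl, hlvl, hpar σ τ hτ, hpar σ τ' hτ']
  rcases Relation.ReflTransGen.total_of_right_unique huniq (up τ i hi) (up τ' i hi') with h | h
  · rcases level_le_of_reflTransGen hlvl h with h | h
    · exact hne h
    · omega
  · rcases level_le_of_reflTransGen hlvl h with h | h
    · exact hne h.symm
    · omega

/-- Upper bound for the probability that the percolation reaches level `n`, by backward induction
on the level. -/
theorem measure_reaches_le {Ω : Type*} [MeasurableSpace Ω] {P : Measure Ω}
    [IsProbabilityMeasure P] {X : I → Ω → ℝ} (hX : iIndepFun X P) (hXm : ∀ i, Measurable (X i))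
    {ν : Measure ℝ} [IsProbabilityMeasure ν] (hν : ∀ i, P.map (X i) = ν)
    (hA : ∀ j, MeasurableSet (A j)) (hv : Function.Injective v)
    (hpar : ∀ σ, ∀ i ∈ ch σ, par i = σ) (hlvl : ∀ i, lvl (v i) = lvl (par i) + 1)
    {f : ℕ → ℕ} (hf : ∀ σ, (ch σ).card = f (lvl σ)) {n : ℕ} {K w : ℕ → ℝ≥0∞}
    (hK : ∀ k < n, ∀ s, 1 - (1 - K (k + 1) * s) ^ f k ≤ K k * (w k + s)) (hn : 1 ≤ K n * w n)
    (m k : ℕ) (hmk : k + m = n) (σ : V) (hσ : lvl σ = k) (z : ℕ → ℝ) :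
    P {ω | Reaches v ch A m k σ z (fun i => X i ω)} ≤
      K k * ∑ j ∈ Finset.Icc k n,
        w j * lmarginal (fun _ : ℕ => ν) (Finset.Ico k j) ((A j).indicator 1) z := by
  classical
  have hAm : ∀ j, Measurable ((A j).indicator (1 : (ℕ → ℝ) → ℝ≥0∞)) := fun j =>
    measurable_one.indicator (hA j)
  induction m generalizing k σ z with
  | zero =>
    obtain rfl : k = n := by omega
    by_cases hz : z ∈ A k
    · simpa [Reaches, hz] using hn
    · simp [Reaches, hz]
  | succ m ih =>
    by_cases hz : z ∈ A k
    swap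
    · simp [Reaches, hz]
    set T : (ℕ → ℝ) → ℝ≥0∞ := fun z => ∑ j ∈ Finset.Icc (k + 1) n,
        w j * lmarginal (fun _ : ℕ => ν) (Finset.Ico (k + 1) j) ((A j).indicator 1) z with hT
    have hTm : Measurable T := by
      refine Finset.measurable_sum _ fun j _ => ?_
      exact ((hAm j).lmarginal _).const_mul _
    have hum : Measurable fun y => Function.update z k y := measurable_update z
    -- The term `j = k` equals `w k` because `z ∈ A k`. In the others, coordinate `k` is integrated
    -- last, which exposes the bound for a child averaged over the child's label.
    have hsum : ∑ j ∈ Finset.Icc k n,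
        w j * lmarginal (fun _ : ℕ => ν) (Finset.Ico k j) ((A j).indicator 1) z =
          w k + ∫⁻ y, T (Function.update z k y) ∂ν := by
      have hI : Finset.Icc k n = insert k (Finset.Icc (k + 1) n) := by
        ext; simp; omega
      rw [hI, Finset.sum_insert (by simp), hT, lintegral_finsetSum]
      · congr 1
        · simp [hz]
        · refine Finset.sum_congr rfl fun j hj => ?_
          have hkj : k < j := by simp at hj; omega
          have hJ : Finset.Ico k j = insert k (Finset.Ico (k + 1) j) := by
            ext; simp; omega
          rw [lintegral_const_mul, hJ, lmarginal_insert _ (hAm j) (by simp)]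
          exact ((hAm j).lmarginal _).comp hum
      · exact fun j _ => (((hAm j).lmarginal _).comp hum).const_mul _
    rw [hsum]
    refine le_trans ?_ (hK k (by omega) _)
    rw [← hσ, ← hf σ, hσ]
    have hset : {ω | Reaches v ch A (m + 1) k σ z (fun i => X i ω)} =
        {ω | ∃ τ ∈ ch σ, (fun i => X i ω) ∈
          {x | Reaches v ch A m (k + 1) (v τ) (Function.update z k (x τ)) x}} := by
      ext ω; simp [Reaches, hz]
    rw [hset]
    have hΦ : ∀ τ, MeasurableSet {p : ℝ × (I → ℝ) |
        Reaches v ch A m (k + 1) (v τ) (Function.update z k p.1) p.2} := fun τ =>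
      Measurable.prodMk (hum.comp measurable_fst) measurable_snd
        (measurableSet_reaches (v := v) (ch := ch) hA m (k + 1) (v τ))
    -- Given `z`, the event of a child depends only on its own label and those of its descendants,
    -- so different children are independent.
    refine measure_exists_le_of_dependsOn hX hXm (ch σ)
      (fun τ => insert τ (descendants v ch m (v τ)))
      (pairwiseDisjoint_descendants hv hpar hlvl m σ) _ (fun τ => ?_) (fun τ x y hxy => ?_)
      (fun τ hτ => ?_)
    · exact (Measurable.prodMk (measurable_pi_apply τ) measurable_id :
        Measurable fun x : I → ℝ => (x τ, x)) (hΦ τ)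
    · simp only [Set.mem_ofPred_eq]
      rw [hxy τ (by simp)]
      exact dependsOn_reaches _ _ _ _ fun i hi => hxy i (by simp [Finset.mem_coe.1 hi])
    · have := measure_eq_lintegral_of_dependsOn hX hXm
        (notMem_descendants hpar hlvl m τ) (hΦ τ) 
        (fun y => dependsOn_reaches m (k + 1) (v τ) (Function.update z k y))
      rw [hν] at this
      refine this.le.trans ?_
      have hTu : Measurable fun y => T (Function.update z k y) := hTm.comp hum
      rw [← lintegral_const_mul _ hTu]
      refine lintegral_mono fun y => ?_
      exact ih (k + 1) (by omega) (v τ) (by rw [hlvl, hpar σ τ hτ, hσ]) _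

end Reaches

/-! ### The affine bound for one branching step and the choice of weights. -/

theorem one_sub_one_sub_pow_mul_le {q : ℝ} (h0 : 0 ≤ q) (h1 : q ≤ 1) (m : ℕ) :
    (1 - (1 - q) ^ (m + 1)) * (1 + m * q / 2) ≤ (m + 1) * q := by
  induction m with
  | zero => simp
  | succ m ih =>
    set u := 1 - (1 - q) ^ (m + 1) with hu
    have hu' : 1 - (1 - q) ^ (m + 1 + 1) = u * (1 - q) + q := by rw [hu]; ring
    rw [hu']
    push_cast
    have hm : (0 : ℝ) ≤ m := m.cast_nonneg
    have hb : 0 < 1 + (m : ℝ) * q / 2 := by positivity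
    refine le_of_mul_le_mul_right ?_ hb
    have h2 := mul_le_mul_of_nonneg_right ih
      (mul_nonneg (sub_nonneg.2 h1) (by positivity : 0 ≤ 1 + ((m : ℝ) + 1) * q / 2))
    -- After inserting the induction hypothesis, the two sides differ by exactly a quarter of this.
    have h3 : 0 ≤ (m + 1) * ((m + 2) : ℝ) * q ^ 3 := by positivity
    nlinarith [h2, h3]

/-- A linear bound for the probability that one of `f` independent events of probability `q`
occurs. -/
theorem one_sub_one_sub_pow_le {q R : ℝ} (h0 : 0 ≤ q) (h1 : q ≤ 1) (hR : 0 < R) {f : ℕ}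
    (hf : 1 ≤ f) : 1 - (1 - q) ^ f ≤
      ((1 - 1 / f) / 2 + R ^ 2 * (f * q)) / (R + (1 - 1 / f) / 2) ^ 2 := by
  obtain ⟨m, rfl⟩ : ∃ m, f = m + 1 := ⟨f - 1, by omega⟩
  have h := one_sub_one_sub_pow_mul_le h0 h1 m
  have hm : (0 : ℝ) ≤ m := m.cast_nonneg
  set u := 1 - (1 - q) ^ (m + 1) with hu
  push_cast
  have hc : (1 - 1 / ((m : ℝ) + 1)) / 2 = m / (2 * (m + 1)) := by field_simp; ring
  rw [hc]
  set c : ℝ := m / (2 * (m + 1)) with hc'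
  have hc0 : 0 ≤ c := by positivity
  set y : ℝ := (m + 1) * q with hy
  have hy0 : 0 ≤ y := by positivity
  have hcy : 1 + (m : ℝ) * q / 2 = 1 + c * y := by rw [hc', hy]; field_simp
  rw [hcy] at h
  have hpos : 0 < 1 + c * y := by positivity
  rw [le_div_iff₀ (by positivity)]
  refine le_of_mul_le_mul_right ?_ hpos
  have h2 : u * (1 + c * y) * (R + c) ^ 2 ≤ y * (R + c) ^ 2 :=
    mul_le_mul_of_nonneg_right h (by positivity)
  -- The tangent to `y / (1 + c y)` at `y = 1 / R` is `(c + R² y) / (R + c)²`; after clearing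
  -- denominators the gap is `c (R y - 1)²`.
  nlinarith [mul_nonneg hc0 (sq_nonneg (R * y - 1)), h2]

/-- Weights for which the backward induction of `measure_reaches_le` runs and gives the bound by
twice the inverse of the energy of the uniform measure on the `n`-th level. -/
theorem exists_weights {n : ℕ} {f : ℕ → ℕ} (hf : ∀ k < n, 1 ≤ f k) {p : ℕ → ℝ}
    (hp : ∀ k ≤ n, 0 < p k) :
    ∃ K w : ℕ → ℝ≥0∞,
      (∀ k < n, ∀ s, 1 - (1 - K (k + 1) * s) ^ f k ≤ K k * (w k + s)) ∧ 1 ≤ K n * w n ∧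
      0 < 1 / p 0 + ∑ k ∈ Finset.range n,
          (1 / p (k + 1) - 1 / p k) / ∏ i ∈ Finset.range (k + 1), (f i : ℝ) ∧
      K 0 * ∑ j ∈ Finset.Icc 0 n, w j * ENNReal.ofReal (p j) ≤
        ENNReal.ofReal (2 / (1 / p 0 + ∑ k ∈ Finset.range n,
          (1 / p (k + 1) - 1 / p k) / ∏ i ∈ Finset.range (k + 1), (f i : ℝ))) := by
  set M : ℕ → ℝ := fun k => ∏ i ∈ Finset.range k, (f i : ℝ) with hMdef
  have hM : ∀ k ≤ n, 0 < M k := fun k hk => Finset.prod_pos fun i hi => by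
    have := hf i (by simp at hi; omega)
    exact_mod_cast this
  have hMs : ∀ k, M (k + 1) = M k * f k := fun k => Finset.prod_range_succ _ _
  set c : ℕ → ℝ := fun k => (1 - 1 / f k) / 2 with hcdef
  have hc : ∀ k < n, 0 ≤ c k := fun k hk => by
    have : (1 : ℝ) ≤ f k := by exact_mod_cast hf k hk
    have : 1 / (f k : ℝ) ≤ 1 := by rw [div_le_one (by linarith)]; exact this
    simp only [hcdef]; linarith
  set t : ℝ := 1 / (p n * M n) with htdef
  have ht : 0 < t := by have := hp n le_rfl; have := hM n le_rfl; positivity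
  -- Tail sums, designed so that `p k * M k * H k = p k * M k * H (k + 1) + c k`. With `R = p k * M
  -- k * H (k + 1)` the denominator `R + c k` of the tangent line is then of the same form one level
  -- up.
  set H : ℕ → ℝ := fun k => ∑ j ∈ Finset.Ico k n, c j / (p j * M j) + t with hHdef
  have hterm : ∀ j < n, 0 ≤ c j / (p j * M j) := fun j hj =>
    div_nonneg (hc j hj) (mul_pos (hp j hj.le) (hM j hj.le)).le
  have hH : ∀ k, 0 < H k := fun k => add_pos_of_nonneg_of_pos
    (Finset.sum_nonneg fun j hj => hterm j (Finset.mem_Ico.1 hj).2) ht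
  have hHs : ∀ k < n, H k = c k / (p k * M k) + H (k + 1) := fun k hk => by
    simp only [hHdef]
    rw [Finset.sum_eq_sum_Ico_succ_bot hk]; ring
  have hHn : H n = t := by simp [hHdef]
  -- Summation by parts, using `1 / M k - 1 / M (k + 1) = 2 * c k / M k`. Thus the truncated energy
  -- is `2 * H 0 - t`, the source of the factor `2`.
  have abel : ∀ m ≤ n, 1 / p 0 + ∑ k ∈ Finset.range m, (1 / p (k + 1) - 1 / p k) / M (k + 1) =
      2 * ∑ k ∈ Finset.range m, c k / (p k * M k) + 1 / (p m * M m) := by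
    intro m
    induction m with
    | zero => intro _; simp [hMdef]
    | succ m ih =>
      intro hm
      rw [Finset.sum_range_succ, ← add_assoc, ih (by omega), Finset.sum_range_succ]
      have h1 := hp m (by omega)
      have h2 := hp (m + 1) hm
      have h3 := hM m (by omega)
      have h4 : (0 : ℝ) < f m := by exact_mod_cast hf m (by omega)
      rw [hMs]
      simp only [hcdef]
      field_simp
      ring
  set E : ℝ := 1 / p 0 + ∑ k ∈ Finset.range n, (1 / p (k + 1) - 1 / p k) / M (k + 1) with hE
  have hEH : E ≤ 2 * H 0 ∧ 0 < E := by
    have h1 := abel n le_rfl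
    have h2 : 0 ≤ ∑ k ∈ Finset.range n, c k / (p k * M k) :=
      Finset.sum_nonneg fun j hj => hterm j (Finset.mem_range.1 hj)
    have h3 : H 0 = ∑ k ∈ Finset.range n, c k / (p k * M k) + t := by
      simp only [hHdef, ← Finset.range_eq_Ico]
    rw [← htdef] at h1
    constructor <;> linarith
  -- For `j < n` the weight is the tangent's intercept divided by `K j`; the last one makes `K n * w
  -- n = 1`.
  let wr : ℕ → ℝ := fun j => if j < n then c j / (M j * p j ^ 2) else 1 / (M j * p j ^ 2)
  have hwr : ∀ j ≤ n, 0 ≤ wr j := fun j hj => by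
    have h1 := hp j hj
    have h2 := hM j hj
    by_cases h : j < n
    · have := hc j h
      simp only [wr, h, if_true]; positivity
    · simp only [wr, h, if_false]; positivity
  have hKpos : ∀ k ≤ n, 0 < 1 / (M k * H k ^ 2) := fun k hk => by
    have := hM k hk; have := hH k; positivity
  refine ⟨fun k => ENNReal.ofReal (1 / (M k * H k ^ 2)), fun j => ENNReal.ofReal (wr j),
    ?_, ?_, hEH.2, ?_⟩
  · intro k hk s
    have hKk := hKpos k hk.le
    have hKk1 := hKpos (k + 1) hk
    rcases eq_or_ne s ⊤ with rfl | hs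
    · have : ENNReal.ofReal (1 / (M k * H k ^ 2)) * (ENNReal.ofReal (wr k) + ⊤) = ⊤ := by
        rw [add_top]
        exact ENNReal.mul_top (by simpa using hKk)
      rw [this]
      exact le_top
    have key : ∀ r : ℝ, 0 ≤ r → 1 / (M (k + 1) * H (k + 1) ^ 2) * r ≤ 1 →
        1 - (1 - 1 / (M (k + 1) * H (k + 1) ^ 2) * r) ^ f k ≤
          1 / (M k * H k ^ 2) * (wr k + r) := by
      intro r hr hr1
      have h1 := hp k hk.le
      have h2 := hM k hk.le
      have h3 := hH (k + 1)
      have h5 : (0 : ℝ) < f k := by exact_mod_cast hf k hk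
      have hHk : p k * M k * H (k + 1) + c k = p k * M k * H k := by
        rw [hHs k hk]; field_simp; ring
      have := one_sub_one_sub_pow_le (mul_nonneg hKk1.le hr) hr1
        (R := p k * M k * H (k + 1)) (by positivity) (hf k hk)
      refine this.trans (le_of_eq ?_)
      change (c k + _) / (p k * M k * H (k + 1) + c k) ^ 2 = _
      rw [hHk, hMs]
      have h4 := hH k
      simp only [wr, hk, if_true]
      field_simp
    set a : ℝ := 1 / (M (k + 1) * H (k + 1) ^ 2) with ha
    -- The real inequality needs `a * r ≤ 1`. Capping is harmless, since truncated subtraction gives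
    -- `1 - a * s = 0` beyond the cap.
    set r : ℝ := min s.toReal (1 / a) with hr
    have hr0 : 0 ≤ r := le_min ENNReal.toReal_nonneg (by positivity)
    have har : a * r ≤ 1 := by
      calc a * r ≤ a * (1 / a) := mul_le_mul_of_nonneg_left (min_le_right _ _) hKk1.le
        _ = 1 := by field_simp
    have hrs : ENNReal.ofReal r ≤ s := by
      rw [ENNReal.ofReal_le_iff_le_toReal hs]; exact min_le_left _ _
    have hlhs : 1 - ENNReal.ofReal a * s ≥ ENNReal.ofReal (1 - a * r) := by
      rcases le_total s.toReal (1 / a) with h | h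
      · have : r = s.toReal := min_eq_left h
        rw [this, ENNReal.ofReal_sub _ (by positivity), ENNReal.ofReal_one,
          ENNReal.ofReal_mul hKk1.le, ENNReal.ofReal_toReal hs]
      · have : r = 1 / a := min_eq_right h
        rw [this]
        have : 1 - a * (1 / a) = 0 := by field_simp; simp
        rw [this]; simp
    calc 1 - (1 - ENNReal.ofReal a * s) ^ f k
        ≤ 1 - ENNReal.ofReal (1 - a * r) ^ f k := tsub_le_tsub_left (pow_le_pow_left' hlhs _) 1
      _ = ENNReal.ofReal (1 - (1 - a * r) ^ f k) := by
          rw [ENNReal.ofReal_sub _ (pow_nonneg (by linarith) _), ENNReal.ofReal_one,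
            ENNReal.ofReal_pow (by linarith)]
      _ ≤ ENNReal.ofReal (1 / (M k * H k ^ 2) * (wr k + r)) :=
          ENNReal.ofReal_le_ofReal (key r hr0 har)
      _ = ENNReal.ofReal (1 / (M k * H k ^ 2)) * (ENNReal.ofReal (wr k) + ENNReal.ofReal r) := by
          rw [ENNReal.ofReal_mul hKk.le, ENNReal.ofReal_add (hwr k hk.le) hr0]
      _ ≤ _ := by gcongr
  · rw [← ENNReal.ofReal_mul (hKpos n le_rfl).le, ← ENNReal.ofReal_one]
    refine ENNReal.ofReal_le_ofReal (le_of_eq ?_)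
    have h1 := hp n le_rfl
    have h2 := hM n le_rfl
    rw [hHn, htdef]
    simp only [wr, lt_irrefl, if_false]
    field_simp
  · have h0 := hKpos 0 (Nat.zero_le n)
    have hsum : ∑ j ∈ Finset.Icc 0 n, ENNReal.ofReal (wr j) * ENNReal.ofReal (p j) =
        ENNReal.ofReal (∑ j ∈ Finset.Icc 0 n, wr j * p j) := by
      rw [ENNReal.ofReal_sum_of_nonneg]
      · refine Finset.sum_congr rfl fun j hj => ?_
        rw [ENNReal.ofReal_mul (hwr j (Finset.mem_Icc.1 hj).2)]
      · intro j hj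
        have := (Finset.mem_Icc.1 hj).2
        exact mul_nonneg (hwr j this) (hp j this).le
    rw [hsum, ← ENNReal.ofReal_mul h0.le]
    refine ENNReal.ofReal_le_ofReal ?_
    have hS : ∑ j ∈ Finset.Icc 0 n, wr j * p j = H 0 := by
      have hI : Finset.Icc 0 n = Finset.range (n + 1) := by ext; simp
      rw [hI, Finset.sum_range_succ]
      simp only [hHdef, ← Finset.range_eq_Ico]
      congr 1
      · refine Finset.sum_congr rfl fun j hj => ?_
        have hj := Finset.mem_range.1 hj
        have h1 := hp j hj.le
        have h2 := hM j hj.le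
        simp only [wr, hj, if_true]
        field_simp
      · have h1 := hp n le_rfl
        have h2 := hM n le_rfl
        simp only [wr, lt_irrefl, if_false, htdef]
        field_simp
    have hM0 : M 0 = 1 := by simp [hMdef]
    have hH0 := hH 0
    rw [hS, hM0, le_div_iff₀ hEH.2]
    have : 1 / (1 * H 0 ^ 2) * H 0 * E = E / H 0 := by field_simp
    rw [this, div_le_iff₀ hH0]
    exact hEH.1

/-! ### Levels, parents and root paths in a tree. -/

section Tree

variable {V : Type*} {G : SimpleGraph V} {ρ : V}

theorem level_root : level G ρ ρ = 0 := by simp [level]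

theorem level_eq_zero_iff (hT : G.IsTree) {σ : V} : level G ρ σ = 0 ↔ σ = ρ := by
  rw [level, (hT.connected ρ σ).dist_eq_zero_iff, eq_comm]

theorem ne_root_of_mem_children {σ τ : V} (h : τ ∈ children G ρ σ) : τ ≠ ρ := by
  rintro rfl
  have := h.2
  rw [level_root] at this
  omega

/-- The path from the root to a child extends the path to its parent. -/
theorem exists_isPath_concat (hT : G.IsTree) {σ τ : V} (h : τ ∈ children G ρ σ) :
    ∃ (q : G.Walk ρ σ) (hστ : G.Adj σ τ), q.IsPath ∧ (q.concat hστ).IsPath := by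
  classical
  obtain ⟨q, hq, hql⟩ := (hT.connected ρ σ).exists_path_of_dist
  refine ⟨q, h.1, hq, hq.concat (fun hτ => ?_) h.1⟩
  have h1 := (SimpleGraph.dist_le (q.takeUntil τ hτ)).trans (q.length_takeUntil_le_length hτ)
  have h2 := h.2
  simp only [level] at h2
  omega

theorem eq_of_mem_children (hT : G.IsTree) {σ σ' τ : V} (h : τ ∈ children G ρ σ)
    (h' : τ ∈ children G ρ σ') : σ = σ' := by
  obtain ⟨q, a, -, hq⟩ := exists_isPath_concat hT h
  obtain ⟨q', a', -, hq'⟩ := exists_isPath_concat hT h'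
  have := congrArg SimpleGraph.Walk.penultimate ((hT.existsUnique_path ρ τ).unique hq hq')
  simpa using this

theorem exists_mem_children (hT : G.IsTree) {τ : V} (hτ : τ ≠ ρ) :
    ∃ σ, τ ∈ children G ρ σ := by
  obtain ⟨q, hq, hql⟩ := (hT.connected ρ τ).exists_path_of_dist
  have hnil : ¬ q.Nil := fun h => hτ h.eq.symm
  refine ⟨q.penultimate, q.adj_penultimate hnil, ?_⟩
  have h1 := SimpleGraph.dist_le q.dropLast
  have h2 : q.dropLast.length + 1 = q.length := by
    have := SimpleGraph.Walk.length_dropLast_add_one hnil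
    simpa using this
  have := hT.dist_eq_dist_add_one_of_adj ρ (q.adj_penultimate hnil)
  simp only [level]
  omega

theorem onPathTo_root_iff {τ : V} : OnPathTo G ρ τ ρ ↔ τ = ρ := by
  constructor
  · rintro ⟨w, hw, hτ⟩
    rw [SimpleGraph.Walk.nil_iff_support_eq.1 (SimpleGraph.Walk.isPath_iff_nil.1 hw)] at hτ
    simpa using hτ
  · rintro rfl
    exact ⟨.nil, .nil, by simp⟩

theorem onPathTo_iff_of_mem_children (hT : G.IsTree) {σ τ υ : V} (h : τ ∈ children G ρ σ) :
    OnPathTo G ρ υ τ ↔ OnPathTo G ρ υ σ ∨ υ = τ := by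
  obtain ⟨q, a, hq, hqa⟩ := exists_isPath_concat hT h
  constructor
  · rintro ⟨w, hw, hυ⟩
    rw [(hT.existsUnique_path ρ τ).unique hw hqa, SimpleGraph.Walk.support_concat] at hυ
    simp only [List.mem_append, List.mem_singleton] at hυ
    rcases hυ with hυ | hυ
    · exact .inl ⟨q, hq, hυ⟩
    · exact .inr hυ
  · rintro (⟨w, hw, hυ⟩ | rfl)
    · refine ⟨_, hqa, ?_⟩
      rw [(hT.existsUnique_path ρ σ).unique hw hq] at hυ
      rw [SimpleGraph.Walk.support_concat]
      simp [hυ]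
    · exact ⟨_, hqa, SimpleGraph.Walk.end_mem_support _⟩

/-- `c 0, …, c n` is a path that starts at the root and moves away from it. -/
structure IsChainTo (G : SimpleGraph V) (ρ : V) (n : ℕ) (c : ℕ → V) : Prop where
  zero : c 0 = ρ
  succ : ∀ i < n, c (i + 1) ∈ children G ρ (c i)

theorem IsChainTo.level {n : ℕ} {c : ℕ → V} (hc : IsChainTo G ρ n c) {i : ℕ} (hi : i ≤ n) :
    level G ρ (c i) = i := by
  induction i with
  | zero => rw [hc.zero, level_root]
  | succ i ih => rw [(hc.succ i hi).2, ih (by omega)]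

theorem IsChainTo.onPathTo_iff (hT : G.IsTree) {n : ℕ} {c : ℕ → V} (hc : IsChainTo G ρ n c)
    {k : ℕ} (hk : k ≤ n) {τ : V} : OnPathTo G ρ τ (c k) ↔ ∃ i ≤ k, τ = c i := by
  induction k with
  | zero => rw [hc.zero, onPathTo_root_iff]; simp [hc.zero]
  | succ k ih =>
    rw [onPathTo_iff_of_mem_children hT (hc.succ k hk), ih (by omega)]
    constructor
    · rintro (⟨i, hi, rfl⟩ | rfl)
      · exact ⟨i, by omega, rfl⟩
      · exact ⟨k + 1, le_rfl, rfl⟩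
    · rintro ⟨i, hi, rfl⟩
      rcases Nat.le_succ_iff.1 hi with hi | rfl
      · exact .inl ⟨i, hi, rfl⟩
      · exact .inr rfl

theorem exists_isChainTo (hT : G.IsTree) (n : ℕ) (σ : V) (hσ : TreePercolation.level G ρ σ = n) :
    ∃ c, IsChainTo G ρ n c ∧ c n = σ := by
  induction n generalizing σ with
  | zero => exact ⟨fun _ => ρ, ⟨rfl, by simp⟩, ((level_eq_zero_iff hT).1 hσ).symm⟩
  | succ n ih =>
    have hne : σ ≠ ρ := by
      rintro rfl
      rw [level_root] at hσ
      omega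
    obtain ⟨τ, hτ⟩ := exists_mem_children hT hne
    obtain ⟨c, hc, hcn⟩ := ih τ (by have := hτ.2; omega)
    refine ⟨fun i => if i ≤ n then c i else σ, ⟨by simp [hc.zero], fun i hi => ?_⟩, by simp⟩
    rcases Nat.lt_succ_iff_lt_or_eq.1 hi with hi | rfl
    · have h1 : i + 1 ≤ n := hi
      simpa [h1, hi.le] using hc.succ i hi
    · simpa [hcn] using hτ

theorem IsChainTo.injOn {n : ℕ} {c : ℕ → V} (hc : IsChainTo G ρ n c) {i j : ℕ} (hi : i ≤ n)
    (hj : j ≤ n) (h : c i = c j) : i = j := by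
  rw [← hc.level hi, ← hc.level hj, h]

/-- The projection of `B` onto the first `k` coordinates (everything for `k = 0`). -/
def initialProj {N : ℕ∞} (B : Set ({j : ℕ // (j : ℕ∞) < N} → ℝ)) (k : ℕ) :
    Set (Finset.range k → ℝ) :=
  {y | k = 0 ∨ ∃ b ∈ B, ∀ (j : {j : ℕ // (j : ℕ∞) < N}) (h : (j : ℕ) ∈ Finset.range k),
    y ⟨j, h⟩ = b j}

theorem IsChainTo.mem_targetPercolation_iff (hT : G.IsTree) {n : ℕ} {c : ℕ → V}
    (hc : IsChainTo G ρ n c) {N : ℕ∞} (B : Set ({j : ℕ // (j : ℕ∞) < N} → ℝ)) (x : V → ℝ)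
    {k : ℕ} (hk : k ≤ n) : c k ∈ targetPercolation G ρ B x ↔
      (fun i : Finset.range k => x (c (i + 1))) ∈ initialProj B k := by
  simp only [targetPercolation, initialProj, Set.mem_ofPred_eq]
  refine or_congr ?_ (exists_congr fun b => and_congr_right fun _ => ?_)
  · rw [← level_eq_zero_iff hT, hc.level hk]
  · refine forall_congr' fun j => ?_
    constructor
    · intro h hj
      have hj' : (j : ℕ) < k := Finset.mem_range.1 hj
      exact h _ ((hc.onPathTo_iff hT hk).2 ⟨j + 1, by omega, rfl⟩) (hc.level (by omega))
    · intro h τ hτ hl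
      obtain ⟨i, hi, rfl⟩ := (hc.onPathTo_iff hT hk).1 hτ
      rw [hc.level (hi.trans hk)] at hl
      subst hl
      exact h (Finset.mem_range.2 (by omega))

/-- Projections of one `B` are consistent: a witness `b` for a vertex also serves its ancestors.
Hence connection to a vertex is the same as its membership in `W`. -/
theorem IsChainTo.mem_targetPercolation_of_le (hT : G.IsTree) {n : ℕ} {c : ℕ → V}
    (hc : IsChainTo G ρ n c) {N : ℕ∞} {B : Set ({j : ℕ // (j : ℕ∞) < N} → ℝ)} {x : V → ℝ}
    {k l : ℕ} (hkl : k ≤ l) (hl : l ≤ n) (h : c l ∈ targetPercolation G ρ B x) :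
    c k ∈ targetPercolation G ρ B x := by
  rcases h with h | ⟨b, hb, h⟩
  · left
    rw [← level_eq_zero_iff hT, hc.level hl] at h
    rw [← level_eq_zero_iff hT, hc.level (hkl.trans hl)]
    omega
  · refine .inr ⟨b, hb, fun j τ hτ => h j τ ?_⟩
    obtain ⟨i, hi, rfl⟩ := (hc.onPathTo_iff hT (hkl.trans hl)).1 hτ
    exact (hc.onPathTo_iff hT hl).2 ⟨i, hi.trans hkl, rfl⟩

theorem IsChainTo.connectsTo_iff (hT : G.IsTree) {n : ℕ} {c : ℕ → V}
    (hc : IsChainTo G ρ n c) {N : ℕ∞} (B : Set ({j : ℕ // (j : ℕ∞) < N} → ℝ)) (x : V → ℝ)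
    {k : ℕ} (hk : k ≤ n) : ConnectsTo G ρ (targetPercolation G ρ B x) (c k) ↔
      c k ∈ targetPercolation G ρ B x := by
  constructor
  · exact fun h => h _ ((hc.onPathTo_iff hT hk).2 ⟨k, le_rfl, rfl⟩)
  · intro h τ hτ
    obtain ⟨i, hi, rfl⟩ := (hc.onPathTo_iff hT hk).1 hτ
    exact hc.mem_targetPercolation_of_le hT hi hk h

end Tree

/-! ### The law of the percolation along a path. -/

section Law

/-- For a closed target set the projections onto initial coordinates are universally
measurable. -/
theorem nullMeasurableSet_initialProj {N : ℕ∞} {B : Set ({j : ℕ // (j : ℕ∞) < N} → ℝ)}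
    (hB : IsClosed B) {k : ℕ} (hk : (k : ℕ∞) ≤ N) (μ : Measure (Finset.range k → ℝ))
    [IsFiniteMeasure μ] : NullMeasurableSet (initialProj B k) μ := by
  rcases Nat.eq_zero_or_pos k with rfl | hk0
  · have : initialProj B 0 = Set.univ := by ext; simp [initialProj]
    rw [this]
    exact MeasurableSet.univ.nullMeasurableSet
  have hlt : ∀ i : Finset.range k, ((i : ℕ) : ℕ∞) < N := fun i =>
    lt_of_lt_of_le (by exact_mod_cast Finset.mem_range.1 i.2) hk
  have : initialProj B k = (fun b (i : Finset.range k) => b ⟨i, hlt i⟩) '' B := by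
    ext y
    simp only [initialProj, Set.mem_ofPred_eq, hk0.ne', false_or, Set.mem_image]
    refine exists_congr fun b => and_congr_right fun _ => ?_
    constructor
    · intro h
      funext i
      exact (h ⟨i, hlt i⟩ i.2).symm
    · rintro rfl j h
      rfl
  rw [this]
  refine nullMeasurableSet_of_analyticSet (hB.analyticSet.image_of_continuous ?_)
  exact continuous_pi fun i => continuous_apply _

variable {V : Type*} {G : SimpleGraph V} {ρ : V} {Ω : Type*} [MeasurableSpace Ω] {P : Measure Ω}
  [IsProbabilityMeasure P] {X : V → Ω → ℝ}

/-- The vertices of a path are distinct, so their labels have a product law that depends only on the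
length. The projection is only null measurable, which suffices for evaluating the image measure. -/
theorem IsChainTo.measure_mem_targetPercolation (hT : G.IsTree)
    (hX : iIndepFun (fun σ : {σ : V // σ ≠ ρ} => X σ) P) (hXm : ∀ σ, σ ≠ ρ → Measurable (X σ))
    {ν : Measure ℝ} (hν : ∀ σ, σ ≠ ρ → P.map (X σ) = ν) [IsProbabilityMeasure ν]
    {N : ℕ∞} {B : Set ({j : ℕ // (j : ℕ∞) < N} → ℝ)} (hB : IsClosed B)
    {n : ℕ} {c : ℕ → V} (hc : IsChainTo G ρ n c) {k : ℕ} (hk : k ≤ n) (hkN : (k : ℕ∞) ≤ N) :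
    P {ω | c k ∈ targetPercolation G ρ B (fun τ => X τ ω)} =
      Measure.pi (fun _ : Finset.range k => ν) (initialProj B k) := by
  have hne : ∀ i : Finset.range k, c (i + 1) ≠ ρ := fun i =>
    ne_root_of_mem_children (hc.succ i (by have := Finset.mem_range.1 i.2; omega))
  have hind : iIndepFun (fun (i : Finset.range k) => X (c (i + 1))) P := by
    refine hX.precomp (g := fun i : Finset.range k => (⟨c (i + 1), hne i⟩ : {σ : V // σ ≠ ρ})) ?_
    intro i j hij
    have h1 := Finset.mem_range.1 i.2
    have h2 := Finset.mem_range.1 j.2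
    have := hc.injOn (i := i + 1) (j := j + 1) (by omega) (by omega) (congrArg Subtype.val hij)
    exact Subtype.ext (by omega)
  have hm : ∀ i : Finset.range k, Measurable (X (c (i + 1))) := fun i => hXm _ (hne i)
  have hlaw := (iIndepFun_iff_map_fun_eq_pi_map fun i => (hm i).aemeasurable).1 hind
  simp only [hν _ (hne _)] at hlaw
  rw [← hlaw, Measure.map_apply₀ (measurable_pi_lambda _ hm).aemeasurable]
  · congr 1
    ext ω
    exact hc.mem_targetPercolation_iff hT B _ hk
  · rw [hlaw]
    exact nullMeasurableSet_initialProj hB hkN _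

end Law

/-! ### The probability of reaching a finite level. -/

section Survival

variable {V : Type*} {G : SimpleGraph V} {ρ : V}

/-- Coordinates not yet revealed are `0`, so updating coordinate `k` turns the labels cut off at `k`
into those cut off at `k + 1`. -/
theorem IsChainTo.reaches {n : ℕ} {c : ℕ → V} (hc : IsChainTo G ρ n c)
    {ch : V → Finset {σ : V // σ ≠ ρ}} (hch : ∀ σ i, i ∈ ch σ ↔ (i : V) ∈ children G ρ σ)
    {A : ℕ → Set (ℕ → ℝ)} {x : V → ℝ} {m k : ℕ} (hkm : k + m = n)
    (hA : ∀ j, k ≤ j → j ≤ n → (fun i => if i < j then x (c (i + 1)) else 0) ∈ A j) :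
    Reaches Subtype.val ch A m k (c k) (fun i => if i < k then x (c (i + 1)) else 0)
      (fun i => x i) := by
  induction m generalizing k with
  | zero => exact hA k le_rfl (by omega)
  | succ m ih =>
    refine ⟨hA k le_rfl (by omega), ?_⟩
    have hmem := hc.succ k (by omega)
    refine ⟨⟨c (k + 1), ne_root_of_mem_children hmem⟩, (hch _ _).2 hmem, ?_⟩
    have := ih (k := k + 1) (by omega) fun j hj => hA j (by omega)
    convert this using 1
    funext i
    rcases lt_trichotomy i k with h | rfl | h
    · rw [Function.update_of_ne h.ne, if_pos h, if_pos (by omega)]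
    · simp
    · rw [Function.update_of_ne h.ne', if_neg (by omega), if_neg (by omega)]

theorem exists_finset_children (hfin : ∀ σ, (G.neighborSet σ).Finite) {f : ℕ → ℕ}
    (hf : ∀ σ, (children G ρ σ).encard = f (level G ρ σ)) :
    ∃ ch : V → Finset {σ : V // σ ≠ ρ}, (∀ σ i, i ∈ ch σ ↔ (i : V) ∈ children G ρ σ) ∧
      ∀ σ, (ch σ).card = f (level G ρ σ) := by
  have hfin' : ∀ σ, {i : {σ : V // σ ≠ ρ} | (i : V) ∈ children G ρ σ}.Finite := fun σ =>
    Set.Finite.preimage Subtype.val_injective.injOn ((hfin σ).subset fun τ hτ => hτ.1)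
  refine ⟨fun σ => (hfin' σ).toFinset, fun σ i => by simp, fun σ => ?_⟩
  have himg : Subtype.val '' {i : {σ : V // σ ≠ ρ} | (i : V) ∈ children G ρ σ} =
      children G ρ σ := by
    ext τ
    constructor
    · rintro ⟨i, hi, rfl⟩
      exact hi
    · exact fun hτ => ⟨⟨τ, ne_root_of_mem_children hτ⟩, hτ, rfl⟩
  have h := hf σ
  rw [← himg, Subtype.val_injective.encard_image, (hfin' σ).encard_eq_coe_toFinset_card] at h
  exact_mod_cast h

/-- The set constrains only the coordinates being integrated, so nothing of the starting point `z`
remains. This turns the bound at the root into one in terms of `p j`. -/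
theorem lmarginal_indicator_restrict (ν : Measure ℝ) (j : ℕ)
    {D : Set (Finset.range j → ℝ)} (hD : MeasurableSet D) (z : ℕ → ℝ) :
    lmarginal (fun _ : ℕ => ν) (Finset.range j)
      (((Finset.range j).restrict ⁻¹' D : Set (ℕ → ℝ)).indicator 1) z =
        Measure.pi (fun _ : Finset.range j => ν) D := by
  have : ∀ y : Finset.range j → ℝ,
      ((Finset.range j).restrict ⁻¹' D : Set (ℕ → ℝ)).indicator (1 : (ℕ → ℝ) → ℝ≥0∞)
        (Function.updateFinset z (Finset.range j) y) = D.indicator 1 y := by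
    intro y
    have hy : (Finset.range j).restrict (Function.updateFinset z (Finset.range j) y) = y := by
      funext i
      simp [Function.updateFinset, i.2]
    have hmem : Function.updateFinset z (Finset.range j) y ∈ (Finset.range j).restrict ⁻¹' D ↔
        y ∈ D := by rw [Set.mem_preimage, hy]
    by_cases h : y ∈ D
    · rw [Set.indicator_of_mem h, Set.indicator_of_mem (hmem.2 h), Pi.one_apply, Pi.one_apply]
    · rw [Set.indicator_of_notMem h, Set.indicator_of_notMem (mt hmem.1 h)]
  simp only [lmarginal, this]
  exact lintegral_indicator_one hD

variable {Ω : Type*} [MeasurableSpace Ω] {P : Measure Ω}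
  [IsProbabilityMeasure P] {X : V → Ω → ℝ}

/-- The probability that the target percolation reaches level `n` is at most twice the inverse of
the energy, truncated at level `n`, of the uniform measure. -/
theorem measure_exists_chain_le (hT : G.IsTree) (hfin : ∀ σ, (G.neighborSet σ).Finite) {f : ℕ → ℕ}
    (hf : ∀ σ, (children G ρ σ).encard = f (level G ρ σ))
    (hX : iIndepFun (fun σ : {σ : V // σ ≠ ρ} => X σ) P) (hXm : ∀ σ, σ ≠ ρ → Measurable (X σ))
    {ν : Measure ℝ} (hν : ∀ σ, σ ≠ ρ → P.map (X σ) = ν) [IsProbabilityMeasure ν]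
    {N : ℕ∞} {B : Set ({j : ℕ // (j : ℕ∞) < N} → ℝ)} {n : ℕ}
    (hf1 : ∀ k < n, 1 ≤ f k) {p : ℕ → ℝ}
    (hp : ∀ k ≤ n, Measure.pi (fun _ : Finset.range k => ν) (initialProj B k) =
      ENNReal.ofReal (p k)) (hp0 : ∀ k ≤ n, 0 < p k) :
    0 < 1 / p 0 + ∑ k ∈ Finset.range n,
          (1 / p (k + 1) - 1 / p k) / ∏ i ∈ Finset.range (k + 1), (f i : ℝ) ∧
    P {ω | ∃ c, IsChainTo G ρ n c ∧
        ∀ k ≤ n, c k ∈ targetPercolation G ρ B (fun τ => X τ ω)} ≤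
      ENNReal.ofReal (2 / (1 / p 0 + ∑ k ∈ Finset.range n,
          (1 / p (k + 1) - 1 / p k) / ∏ i ∈ Finset.range (k + 1), (f i : ℝ))) := by
  obtain ⟨K, w, hK, hn, hpos, hKw⟩ := exists_weights hf1 hp0
  refine ⟨hpos, le_trans ?_ hKw⟩
  obtain ⟨ch, hch, hcard⟩ := exists_finset_children hfin hf
  -- Measurable hulls make the induction applicable. They only enlarge the event, keep the measures
  -- `p j`, and need not be consistent with one another.
  let D : (j : ℕ) → Set (Finset.range j → ℝ) := fun j =>
    toMeasurable (Measure.pi fun _ : Finset.range j => ν) (initialProj B j)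
  have hD : ∀ j, MeasurableSet (D j) := fun j => measurableSet_toMeasurable _ _
  let A : ℕ → Set (ℕ → ℝ) := fun j => (Finset.range j).restrict ⁻¹' D j
  have hA : ∀ j, MeasurableSet (A j) := fun j => Finset.measurable_restrict _ (hD j)
  choose par hpar using fun i : {σ : V // σ ≠ ρ} => exists_mem_children hT i.2
  have hbound := measure_reaches_le (P := P) (v := Subtype.val) (ch := ch) (A := A) (par := par)
    (lvl := level G ρ) hX (fun i => hXm i i.2) (fun i => hν i i.2) hA Subtype.val_injective
    (fun σ i hi => eq_of_mem_children hT (hpar i) ((hch σ i).1 hi)) (fun i => (hpar i).2)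
    hcard hK hn n 0 (by omega) ρ level_root (fun _ => 0)
  calc _ ≤ P {ω | Reaches Subtype.val ch A n 0 ρ (fun _ => 0)
        (fun i : {σ : V // σ ≠ ρ} => X i ω)} := by
        refine measure_mono ?_
        rintro ω ⟨c, hc, hcW⟩
        have := hc.reaches (x := fun τ => X τ ω) (k := 0) (m := n) (A := A) hch (by omega) ?_
        · simpa [hc.zero] using this
        · intro j _ hj
          refine subset_toMeasurable _ _ ?_
          have := (hc.mem_targetPercolation_iff hT B _ hj).1 (hcW j hj)
          convert this using 1
          funext i
          simp [Finset.mem_range.1 i.2]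
    _ ≤ _ := hbound
    _ = _ := by
        congr 1
        refine Finset.sum_congr rfl fun j hj => ?_
        rw [← hp j (Finset.mem_Icc.1 hj).2, ← Finset.range_eq_Ico,
          lmarginal_indicator_restrict ν j (hD j), measure_toMeasurable]

/-- The path followed by a ray up to level `n`. -/
theorem exists_isChainTo_of_boundary {N : ℕ∞} (ξ : Boundary G ρ N) {n : ℕ}
    (hT : G.IsTree) (hn : (n : ℕ∞) ≤ N) :
    ∃ c, IsChainTo G ρ n c ∧ ∀ (k : ℕ) (hk : (k : ℕ∞) ≤ N), c k = ξ.1 ⟨k, hk⟩ := by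
  classical
  have hle : ∀ i ≤ n, (i : ℕ∞) ≤ N := fun i hi => le_trans (by exact_mod_cast hi) hn
  refine ⟨fun i => if h : (i : ℕ∞) ≤ N then ξ.1 ⟨i, h⟩ else ρ, ⟨?_, fun i hi => ?_⟩,
    fun k hk => by simp only [hk, dif_pos]⟩
  · have h0 : ((0 : ℕ) : ℕ∞) ≤ N := by simp
    simp only [h0, dif_pos]
    exact (level_eq_zero_iff hT).1 (ξ.2.1 ⟨0, h0⟩)
  · simp only [hle i hi.le, hle (i + 1) hi, dif_pos]
    exact ⟨ξ.2.2 _ _ rfl, by rw [ξ.2.1, ξ.2.1]⟩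

end Survival

variable {V : Type*} {G : SimpleGraph V} {ρ : V}

/-! ### The uniform measure on the boundary, from independent uniform digits. -/

section UniformMeasure

/-- The vertex reached from the root by choosing the child number `u i` at level `i`. -/
def walkDown (ρ : V) (child : V → ℕ → V) (u : ℕ → ℕ) : ℕ → V
  | 0 => ρ
  | k + 1 => child (walkDown ρ child u k) (u k)

theorem walkDown_congr {child : V → ℕ → V} {u u' : ℕ → ℕ} {k : ℕ} (h : ∀ i < k, u i = u' i) :
    walkDown ρ child u k = walkDown ρ child u' k := by
  induction k with
  | zero => rfl
  | succ k ih =>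
    simp only [walkDown]
    rw [ih fun i hi => h i (by omega), h k (by omega)]

theorem exists_bijOn_children {f : ℕ → ℕ}
    (hf : ∀ σ, (children G ρ σ).encard = f (level G ρ σ)) :
    ∃ child : V → ℕ → V, ∀ σ,
      Set.BijOn (child σ) (Set.Iio (f (level G ρ σ))) (children G ρ σ) := by
  have : ∀ σ, ∃ g : ℕ → V, Set.BijOn g (Set.Iio (f (level G ρ σ))) (children G ρ σ) := by
    intro σ
    have : Nonempty V := ⟨ρ⟩
    refine (Set.finite_Iio _).exists_bijOn_of_encard_eq ?_
    rw [hf σ, ← Set.Finite.cast_ncard_eq (Set.finite_Iio _)]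
    simp
  choose g hg using this
  exact ⟨g, hg⟩

theorem isChainTo_walkDown {f : ℕ → ℕ} {child : V → ℕ → V}
    (hchild : ∀ σ, Set.BijOn (child σ) (Set.Iio (f (level G ρ σ))) (children G ρ σ))
    {u : ℕ → ℕ} {n : ℕ} (hu : ∀ i < n, u i < f i) :
    IsChainTo G ρ n (walkDown ρ child u) := by
  induction n with
  | zero => exact ⟨rfl, by simp⟩
  | succ n ih =>
    have h := ih fun i hi => hu i (by omega)
    refine ⟨rfl, fun i hi => ?_⟩
    rcases Nat.lt_succ_iff_lt_or_eq.1 hi with hi | rfl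
    · exact h.succ i hi
    · refine (hchild _).mapsTo ?_
      rw [h.level le_rfl]
      exact hu i (by omega)

theorem IsChainTo.eq_of_eq (hT : G.IsTree) {n k : ℕ} {c c' : ℕ → V} (hc : IsChainTo G ρ n c)
    (hc' : IsChainTo G ρ n c') (hk : k ≤ n) (h : c k = c' k) {i : ℕ} (hi : i ≤ k) :
    c i = c' i := by
  induction k with
  | zero => rw [Nat.le_zero.1 hi, h]
  | succ k ih =>
    rcases Nat.le_succ_iff.1 hi with hi | rfl
    · refine ih (by omega) ?_ hi
      have := hc'.succ k hk
      rw [← h] at this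
      exact eq_of_mem_children hT (hc.succ k hk) this
    · exact h

/-- Parents are unique and children are numbered bijectively, so a vertex determines the digits
leading to it: its cylinder of rays corresponds to a cylinder of digits. -/
theorem walkDown_eq_iff (hT : G.IsTree) {f : ℕ → ℕ} {child : V → ℕ → V}
    (hchild : ∀ σ, Set.BijOn (child σ) (Set.Iio (f (level G ρ σ))) (children G ρ σ))
    {n : ℕ} {c : ℕ → V} (hc : IsChainTo G ρ n c) :
    ∃ a : ℕ → ℕ, (∀ i < n, a i < f i) ∧ ∀ u : ℕ → ℕ, (∀ i < n, u i < f i) →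
      (walkDown ρ child u n = c n ↔ ∀ i < n, u i = a i) := by
  have : ∀ i, ∃ a, i < n → a < f i ∧ child (c i) a = c (i + 1) := by
    intro i
    by_cases hi : i < n
    · obtain ⟨a, ha, hac⟩ := (hchild (c i)).surjOn (hc.succ i hi)
      rw [hc.level hi.le] at ha
      exact ⟨a, fun _ => ⟨ha, hac⟩⟩
    · exact ⟨0, fun h => absurd h hi⟩
  choose a ha using this
  have hca : ∀ k ≤ n, walkDown ρ child a k = c k := by
    intro k hk
    induction k with
    | zero => exact hc.zero.symm
    | succ k ih =>
      simp only [walkDown]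
      rw [ih (by omega), (ha k hk).2]
  refine ⟨a, fun i hi => (ha i hi).1, fun u hu => ⟨fun h i hi => ?_, fun h => ?_⟩⟩
  · have hw := isChainTo_walkDown hchild hu
    have h1 := hw.eq_of_eq hT hc le_rfl h hi.le
    have h2 := hw.eq_of_eq hT hc le_rfl h (i := i + 1) hi
    simp only [walkDown] at h2
    rw [h1, ← (ha i hi).2] at h2
    refine (hchild (c i)).injOn ?_ ?_ h2
    · rw [hc.level hi.le]; exact hu i hi
    · rw [hc.level hi.le]; exact (ha i hi).1
  · rw [walkDown_congr h, hca n le_rfl]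

theorem measurableSet_boundary_eq {N : ℕ∞} (k : {k : ℕ // (k : ℕ∞) ≤ N}) (v : V) :
    MeasurableSet {η : Boundary G ρ N | η.1 k = v} :=
  (le_iSup (fun k : {k : ℕ // (k : ℕ∞) ≤ N} =>
    MeasurableSpace.comap (fun ξ : Boundary G ρ N => ξ.1 k) ⊤) k) _ ⟨{v}, trivial, rfl⟩

/-- The uniform probability measure on the boundary of a spherically symmetric tree. -/
theorem exists_uniform_measure_boundary (hT : G.IsTree) {f : ℕ → ℕ}
    (hf : ∀ σ, (children G ρ σ).encard = f (level G ρ σ)) {N : ℕ∞}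
    (hf1 : ∀ k : ℕ, (k : ℕ∞) < N → 1 ≤ f k) :
    ∃ μ : Measure (Boundary G ρ N), IsProbabilityMeasure μ ∧
      ∀ (ξ : Boundary G ρ N) (k : ℕ) (hk : (k : ℕ∞) ≤ N),
        μ {η | η.1 ⟨k, hk⟩ = ξ.1 ⟨k, hk⟩} = (∏ i ∈ Finset.range k, (f i : ℝ≥0∞))⁻¹ := by
  classical
  obtain ⟨child, hchild⟩ := exists_bijOn_children hf
  -- The type `Fin (f k - 1 + 1)` is nonempty for every `k` and is `Fin (f k)` when `1 ≤ f k`, that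
  -- is, at every level below `N`; digits from level `N` on are never read.
  let lam : (k : ℕ) → Measure (Fin (f k - 1 + 1)) := fun k =>
    (PMF.uniformOfFintype (Fin (f k - 1 + 1))).toMeasure
  let code : ((k : ℕ) → Fin (f k - 1 + 1)) → ℕ → ℕ := fun u k => u k
  have hlt : ∀ n : ℕ, (n : ℕ∞) ≤ N → ∀ i < n, (i : ℕ∞) < N := fun n hn i hi =>
    lt_of_lt_of_le (by exact_mod_cast hi) hn
  have hcode : ∀ u (n : ℕ), (n : ℕ∞) ≤ N → ∀ i < n, code u i < f i := by
    intro u n hn i hi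
    have h1 := hf1 i (hlt n hn i hi)
    have h2 := (u i).2
    simp only [code]
    omega
  have hchain : ∀ u (n : ℕ), (n : ℕ∞) ≤ N → IsChainTo G ρ n (walkDown ρ child (code u)) :=
    fun u n hn => isChainTo_walkDown hchild (hcode u n hn)
  let φ : ((k : ℕ) → Fin (f k - 1 + 1)) → Boundary G ρ N := fun u =>
    ⟨fun k => walkDown ρ child (code u) k, fun k => (hchain u k k.2).level le_rfl, fun k l hkl => by
      have := (hchain u l l.2).succ k (by omega)
      rw [← hkl] at this
      exact this.1⟩
  have hφ : Measurable φ := by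
    rw [measurable_iff_comap_le, Boundary.measurableSpace, MeasurableSpace.comap_iSup]
    refine iSup_le fun k => ?_
    rw [MeasurableSpace.comap_comp]
    rintro _ ⟨s, -, rfl⟩
    let e : ((i : Finset.range (k : ℕ)) → Fin (f i - 1 + 1)) → ℕ → ℕ := fun y i =>
      if h : i ∈ Finset.range (k : ℕ) then y ⟨i, h⟩ else 0
    have : ((fun ξ : Boundary G ρ N => ξ.1 k) ∘ φ) ⁻¹' s =
        (Finset.range (k : ℕ)).restrict ⁻¹' {y | walkDown ρ child (e y) k ∈ s} := by
      ext u
      have : walkDown ρ child (code u) k =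
          walkDown ρ child (e ((Finset.range (k : ℕ)).restrict u)) k := by
        refine walkDown_congr fun i hi => ?_
        simp [code, e, hi]
      simp only [Set.mem_preimage, Function.comp_apply, Set.mem_ofPred_eq, ← this]
      rfl
    rw [this]
    exact Finset.measurable_restrict _ (Set.toFinite _).measurableSet
  refine ⟨(Measure.infinitePi lam).map φ, Measure.isProbabilityMeasure_map hφ.aemeasurable,
    fun ξ k hk => ?_⟩
  rw [Measure.map_apply hφ (measurableSet_boundary_eq _ _)]
  obtain ⟨c, hc, hcξ⟩ := exists_isChainTo_of_boundary ξ hT hk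
  obtain ⟨a, ha, hiff⟩ := walkDown_eq_iff hT hchild hc
  have hset : φ ⁻¹' {η | η.1 ⟨k, hk⟩ = ξ.1 ⟨k, hk⟩} =
      Set.pi (Finset.range k) (fun i => {b : Fin (f i - 1 + 1) | (b : ℕ) = a i}) := by
    ext u
    rw [Set.mem_preimage, Set.mem_ofPred_eq, ← hcξ k hk]
    refine (hiff (code u) (hcode u k hk)).trans ?_
    simp [code]
  rw [hset, Measure.infinitePi_pi _ fun i _ => (Set.toFinite _).measurableSet,
    ENNReal.prod_inv_distrib]
  · refine Finset.prod_congr rfl fun i hi => ?_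
    have hi := Finset.mem_range.1 hi
    have h1 := hf1 i (hlt k hk i hi)
    have h2 : f i - 1 + 1 = f i := by omega
    have h3 : {b : Fin (f i - 1 + 1) | (b : ℕ) = a i} =
        {(⟨a i, by have := ha i hi; omega⟩ : Fin (f i - 1 + 1))} := by
      ext b
      simp [Fin.ext_iff]
    rw [h3, PMF.toMeasure_apply_singleton _ _ (measurableSet_singleton _)]
    simp only [PMF.uniformOfFintype_apply, Fintype.card_fin]
    congr 2
  · intro i _ j _ _
    right
    simp

end UniformMeasure


/-! ### The energy of the uniform measure. -/

section Energy

theorem boundary_eq_of_le (hT : G.IsTree) {N : ℕ∞} (ξ η : Boundary G ρ N)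
    {k i : ℕ} (hk : (k : ℕ∞) ≤ N) (hi : (i : ℕ∞) ≤ N) (hik : i ≤ k)
    (h : ξ.1 ⟨k, hk⟩ = η.1 ⟨k, hk⟩) : ξ.1 ⟨i, hi⟩ = η.1 ⟨i, hi⟩ := by
  obtain ⟨c, hc, hcξ⟩ := exists_isChainTo_of_boundary ξ hT hk
  obtain ⟨c', hc', hcη⟩ := exists_isChainTo_of_boundary η hT hk
  rw [← hcξ, ← hcη]
  exact hc.eq_of_eq hT hc' le_rfl (by rw [hcξ k hk, hcη k hk, h]) hik

open Classical in
-- Telescoping of `1 / p` over the common levels. Truncated subtraction can only increase the sum,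
-- so no monotonicity of `p` is needed.
theorem inv_le_add_tsum {N : ℕ∞} (ξ η : Boundary G ρ N) (p : ℕ → ℝ≥0∞) (m : ℕ)
    (hm : ∀ k ≤ m, ∃ hk : (k : ℕ∞) ≤ N, ξ.1 ⟨k, hk⟩ = η.1 ⟨k, hk⟩) :
    (p m)⁻¹ ≤ (p 0)⁻¹ + ∑' k : ℕ,
      if ∃ hk : ((k + 1 : ℕ) : ℕ∞) ≤ N, η.1 ⟨k + 1, hk⟩ = ξ.1 ⟨k + 1, hk⟩
        then (p (k + 1))⁻¹ - (p k)⁻¹ else 0 := by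
  have h1 : ∀ m, (p m)⁻¹ ≤ (p 0)⁻¹ + ∑ k ∈ Finset.range m, ((p (k + 1))⁻¹ - (p k)⁻¹) := by
    intro m
    induction m with
    | zero => simp
    | succ m ih =>
      rw [Finset.sum_range_succ, ← add_assoc]
      exact le_add_tsub.trans (add_le_add_left ih _)
  refine (h1 m).trans (add_le_add_right ?_ _)
  refine le_trans (Finset.sum_le_sum fun k hk => ?_) (ENNReal.sum_le_tsum (Finset.range m))
  obtain ⟨hk', h⟩ := hm (k + 1) (Finset.mem_range.1 hk)
  rw [if_pos ⟨hk', h.symm⟩]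

open Classical in
theorem extendGauge_meetLevel_inv_le (hT : G.IsTree) {N : ℕ∞} (ξ η : Boundary G ρ N)
    (p : ℕ → ℝ≥0∞) : (extendGauge p (meetLevel ξ η))⁻¹ ≤ (p 0)⁻¹ + ∑' k : ℕ,
      if ∃ hk : ((k + 1 : ℕ) : ℕ∞) ≤ N, η.1 ⟨k + 1, hk⟩ = ξ.1 ⟨k + 1, hk⟩
        then (p (k + 1))⁻¹ - (p k)⁻¹ else 0 := by
  have hmeet : ∀ m : ℕ, (m : ℕ∞) ≤ meetLevel ξ η →
      ∀ k ≤ m, ∃ hk : (k : ℕ∞) ≤ N, ξ.1 ⟨k, hk⟩ = η.1 ⟨k, hk⟩ := by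
    intro m hm k hk
    rcases Nat.eq_zero_or_pos k with rfl | hk0
    · have h0 : ((0 : ℕ) : ℕ∞) ≤ N := by simp
      refine ⟨h0, ?_⟩
      rw [(level_eq_zero_iff hT).1 (ξ.2.1 ⟨0, h0⟩), (level_eq_zero_iff hT).1 (η.2.1 ⟨0, h0⟩)]
    · have hlt : ((k - 1 : ℕ) : ℕ∞) < meetLevel ξ η :=
        lt_of_lt_of_le (by exact_mod_cast (by omega : k - 1 < m)) hm
      obtain ⟨l, hl⟩ := lt_iSup_iff.1 hlt
      obtain ⟨heq, hl⟩ := lt_iSup_iff.1 hl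
      have hl : k - 1 < (l : ℕ) := by exact_mod_cast hl
      have hkl : k ≤ (l : ℕ) := by omega
      have hkN : (k : ℕ∞) ≤ N := le_trans (by exact_mod_cast hkl) l.2
      exact ⟨hkN, boundary_eq_of_le hT ξ η l.2 hkN hkl heq⟩
  rcases h : meetLevel ξ η with _ | m
  · change (⨅ n, p n)⁻¹ ≤ _
    -- For equal infinite rays the integrand is the supremum of the `(p m)⁻¹`, so the finite case
    -- applies to every `m`.
    rw [ENNReal.inv_iInf]
    refine iSup_le fun m => inv_le_add_tsum ξ η p m (hmeet m ?_)
    rw [h]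
    exact le_top
  · exact inv_le_add_tsum ξ η p m (hmeet m h.ge)

open Classical in
/-- The energy of a measure that is uniform on each level. -/
theorem energy_le (hT : G.IsTree) {N : ℕ∞} {μ : Measure (Boundary G ρ N)}
    [IsProbabilityMeasure μ] {M : ℕ → ℝ≥0∞}
    (hμ : ∀ (ξ : Boundary G ρ N) (k : ℕ) (hk : (k : ℕ∞) ≤ N),
        μ {η | η.1 ⟨k, hk⟩ = ξ.1 ⟨k, hk⟩} = (M k)⁻¹) (p : ℕ → ℝ≥0∞) :
    energy p μ ≤ (p 0)⁻¹ + ∑' k : ℕ, if ((k + 1 : ℕ) : ℕ∞) ≤ N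
      then ((p (k + 1))⁻¹ - (p k)⁻¹) * (M (k + 1))⁻¹ else 0 := by
  have inner : ∀ ξ : Boundary G ρ N, ∫⁻ η, (extendGauge p (meetLevel ξ η))⁻¹ ∂μ ≤
      (p 0)⁻¹ + ∑' k : ℕ, if ((k + 1 : ℕ) : ℕ∞) ≤ N
        then ((p (k + 1))⁻¹ - (p k)⁻¹) * (M (k + 1))⁻¹ else 0 := by
    intro ξ
    refine (lintegral_mono fun η => extendGauge_meetLevel_inv_le hT ξ η p).trans ?_
    have hind : ∀ (k : ℕ) (hk : ((k + 1 : ℕ) : ℕ∞) ≤ N),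
        (fun η : Boundary G ρ N =>
          if ∃ hk : ((k + 1 : ℕ) : ℕ∞) ≤ N, η.1 ⟨k + 1, hk⟩ = ξ.1 ⟨k + 1, hk⟩
            then (p (k + 1))⁻¹ - (p k)⁻¹ else 0) =
        {η : Boundary G ρ N | η.1 ⟨k + 1, hk⟩ = ξ.1 ⟨k + 1, hk⟩}.indicator
          (fun _ => (p (k + 1))⁻¹ - (p k)⁻¹) := by
      intro k hk
      funext η
      simp only [hk, exists_true_left]
      rfl
    have hno : ∀ k : ℕ, ¬ ((k + 1 : ℕ) : ℕ∞) ≤ N →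
        (fun η : Boundary G ρ N =>
          if ∃ hk : ((k + 1 : ℕ) : ℕ∞) ≤ N, η.1 ⟨k + 1, hk⟩ = ξ.1 ⟨k + 1, hk⟩
            then (p (k + 1))⁻¹ - (p k)⁻¹ else 0) = fun _ => 0 := by
      intro k hk
      funext η
      exact if_neg fun ⟨h, _⟩ => hk h
    rw [lintegral_add_left measurable_const, lintegral_tsum]
    · rw [lintegral_const, measure_univ, mul_one]
      refine add_le_add_right (ENNReal.tsum_le_tsum fun k => ?_) _
      by_cases hk : ((k + 1 : ℕ) : ℕ∞) ≤ N
      · rw [hind k hk, lintegral_indicator_const (measurableSet_boundary_eq _ _), hμ, if_pos hk]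
      · rw [hno k hk, if_neg hk, lintegral_zero]
    · intro k
      by_cases hk : ((k + 1 : ℕ) : ℕ∞) ≤ N
      · rw [hind k hk]
        exact (measurable_const.indicator (measurableSet_boundary_eq _ _)).aemeasurable
      · rw [hno k hk]
        exact aemeasurable_const
  calc energy p μ ≤ ∫⁻ _, _ ∂μ := lintegral_mono inner
    _ = _ := by rw [lintegral_const, measure_univ, mul_one]

end Energy


/-! ### From the bounds at finite levels to positive capacity. -/

theorem finite_setOf_level_eq (hT : G.IsTree) (hfin : ∀ σ, (G.neighborSet σ).Finite) (k : ℕ) :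
    {σ | level G ρ σ = k}.Finite := by
  induction k with
  | zero =>
    refine (Set.finite_singleton ρ).subset fun σ hσ => ?_
    exact (level_eq_zero_iff hT).1 hσ
  | succ k ih =>
    refine (ih.biUnion fun τ _ => hfin τ).subset fun σ hσ => ?_
    have hσ' : level G ρ σ = k + 1 := hσ
    have hne : σ ≠ ρ := by
      rintro rfl
      rw [level_root] at hσ'
      omega
    obtain ⟨τ, hτ⟩ := exists_mem_children hT hne
    refine Set.mem_biUnion (x := τ) ?_ hτ.1
    have := hτ.2
    show level G ρ τ = k
    omega

/-- A bound for the partial sums of length at most `N` bounds the sum cut off at `N`. -/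
theorem add_tsum_le_of_forall_sum_le {N : ℕ∞} {a : ℝ≥0∞} {g : ℕ → ℝ≥0∞} {C : ℝ≥0∞}
    (h : ∀ n : ℕ, (n : ℕ∞) ≤ N → a + ∑ k ∈ Finset.range n, g k ≤ C) :
    a + ∑' k : ℕ, (open Classical in if ((k + 1 : ℕ) : ℕ∞) ≤ N then g k else 0) ≤ C := by
  classical
  rw [ENNReal.tsum_eq_iSup_nat, ENNReal.add_iSup]
  refine iSup_le fun n => ?_
  by_cases hn : (n : ℕ∞) ≤ N
  · refine le_trans (add_le_add_right (Finset.sum_le_sum fun k _ => ?_) _) (h n hn)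
    split_ifs <;> simp
  -- Here `N = m` is finite and smaller than `n`; the terms from `m` on vanish.
  · obtain ⟨m, rfl⟩ := ENat.ne_top_iff_exists.1 (ne_top_of_lt (not_le.1 hn))
    have hmn : m < n := by exact_mod_cast not_le.1 hn
    refine le_trans (add_le_add_right ?_ _) (h m le_rfl)
    rw [← Finset.sum_subset (Finset.range_mono hmn.le)]
    · refine Finset.sum_le_sum fun k _ => ?_
      split_ifs <;> simp
    · intro k _ hk
      refine if_neg fun h => hk (Finset.mem_range.2 ?_)
      have : k + 1 ≤ m := by exact_mod_cast h
      omega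

theorem add_sum_eq_ofReal {n : ℕ} {p : ℕ → ℝ≥0∞} {f : ℕ → ℕ} (hf : ∀ k < n, 1 ≤ f k)
    (hp0 : ∀ k ≤ n, p k ≠ 0) (hp1 : ∀ k, p k ≠ ⊤) (hp : ∀ k < n, p (k + 1) ≤ p k) :
    (p 0)⁻¹ + ∑ k ∈ Finset.range n, ((p (k + 1))⁻¹ - (p k)⁻¹) *
        (∏ i ∈ Finset.range (k + 1), (f i : ℝ≥0∞))⁻¹ =
      ENNReal.ofReal (1 / (p 0).toReal + ∑ k ∈ Finset.range n,
          (1 / (p (k + 1)).toReal - 1 / (p k).toReal) /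
            ∏ i ∈ Finset.range (k + 1), (f i : ℝ)) := by
  have hpos : ∀ k ≤ n, 0 < (p k).toReal := fun k hk => ENNReal.toReal_pos (hp0 k hk) (hp1 k)
  have hinv : ∀ k ≤ n, (p k)⁻¹ = ENNReal.ofReal (1 / (p k).toReal) := fun k hk => by
    rw [one_div, ENNReal.ofReal_inv_of_pos (hpos k hk), ENNReal.ofReal_toReal (hp1 k)]
  have hdiff : ∀ k < n, 0 ≤ 1 / (p (k + 1)).toReal - 1 / (p k).toReal := fun k hk => by
    have h1 := hpos (k + 1) hk
    have h2 : (p (k + 1)).toReal ≤ (p k).toReal := ENNReal.toReal_mono (hp1 k) (hp k hk)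
    have := one_div_le_one_div_of_le h1 h2
    linarith
  have hM : ∀ k < n, 0 < ∏ i ∈ Finset.range (k + 1), (f i : ℝ) := fun k hk =>
    Finset.prod_pos fun i hi => by
      have := hf i (by have := Finset.mem_range.1 hi; omega)
      exact_mod_cast this
  have hnonneg : ∀ k ∈ Finset.range n, 0 ≤ (1 / (p (k + 1)).toReal - 1 / (p k).toReal) /
      ∏ i ∈ Finset.range (k + 1), (f i : ℝ) := fun k hk =>
    div_nonneg (hdiff k (Finset.mem_range.1 hk)) (hM k (Finset.mem_range.1 hk)).le
  rw [ENNReal.ofReal_add (one_div_nonneg.2 (hpos 0 (Nat.zero_le n)).le)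
    (Finset.sum_nonneg hnonneg), ENNReal.ofReal_sum_of_nonneg hnonneg, ← hinv 0 (Nat.zero_le n)]
  congr 1
  refine Finset.sum_congr rfl fun k hk => ?_
  have hk := Finset.mem_range.1 hk
  rw [div_eq_mul_inv, ENNReal.ofReal_mul (hdiff k hk), ENNReal.ofReal_inv_of_pos (hM k hk),
    ENNReal.ofReal_sub _ (one_div_nonneg.2 (hpos k hk.le).le), ← hinv k hk.le, ← hinv (k + 1) hk,
    ENNReal.ofReal_prod_of_nonneg fun i _ => Nat.cast_nonneg _]
  simp

/-- Positive survival probability implies positive capacity. -/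
theorem capacity_pos_of_measure_reachesBoundary_pos {N : ℕ∞} (hG : IsRootedTree G ρ N) {f : ℕ → ℕ}
    (hf : ∀ σ, (children G ρ σ).encard = f (level G ρ σ))
    {Ω : Type*} [MeasurableSpace Ω] {P : Measure Ω} [IsProbabilityMeasure P] {X : V → Ω → ℝ}
    (hXm : ∀ σ, σ ≠ ρ → Measurable (X σ))
    (hX : iIndepFun (fun σ : {σ : V // σ ≠ ρ} => X σ) P)
    {ν : Measure ℝ} [IsProbabilityMeasure ν] (hν : ∀ σ, σ ≠ ρ → P.map (X σ) = ν)
    {B : Set ({j : ℕ // (j : ℕ∞) < N} → ℝ)} (hB : IsClosed B)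
    (hpos : 0 < P {ω | ReachesBoundary G ρ N (targetPercolation G ρ B (fun τ => X τ ω))}) :
    0 < capacity G ρ N
      (fun k => Measure.pi (fun _ : Finset.range k => ν) (initialProj B k)) := by
  have hT := hG.isTree
  set Q := P {ω | ReachesBoundary G ρ N (targetPercolation G ρ B (fun τ => X τ ω))} with hQ
  set p : ℕ → ℝ≥0∞ := fun k => Measure.pi (fun _ : Finset.range k => ν) (initialProj B k) with hpdef
  obtain ⟨ω₀, ξ₀, -⟩ := nonempty_of_measure_ne_zero hpos.ne'
  have hle : ∀ {n : ℕ}, (n : ℕ∞) ≤ N → ∀ k ≤ n, (k : ℕ∞) ≤ N := fun hn k hk =>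
    le_trans (by exact_mod_cast hk) hn
  have hchain : ∀ n : ℕ, (n : ℕ∞) ≤ N → ∃ c, IsChainTo G ρ n c := fun n hn => by
    obtain ⟨c, hc, -⟩ := exists_isChainTo_of_boundary ξ₀ hT hn
    exact ⟨c, hc⟩
  have hf1 : ∀ k : ℕ, (k : ℕ∞) < N → 1 ≤ f k := by
    intro k hk
    obtain ⟨c, hc⟩ := hchain k hk.le
    have h1 := hc.level le_rfl
    have h2 := hG.children_nonempty (c k) (by rw [h1]; exact hk)
    have h3 := hf (c k)
    rw [h1] at h3
    have h4 := Set.encard_pos.2 h2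
    rw [h3] at h4
    exact_mod_cast h4
  have hf1' : ∀ n : ℕ, (n : ℕ∞) ≤ N → ∀ k < n, 1 ≤ f k := fun n hn k hk =>
    hf1 k (lt_of_lt_of_le (by exact_mod_cast hk) hn)
  have hsub : ∀ n : ℕ, (n : ℕ∞) ≤ N → Q ≤ P {ω | ∃ c, IsChainTo G ρ n c ∧
      ∀ k ≤ n, c k ∈ targetPercolation G ρ B (fun τ => X τ ω)} := by
    intro n hn
    refine measure_mono ?_
    rintro ω ⟨ξ, hξ⟩
    obtain ⟨c, hc, hcξ⟩ := exists_isChainTo_of_boundary ξ hT hn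
    refine ⟨c, hc, fun k hk => ?_⟩
    rw [hcξ k (hle hn k hk)]
    exact hξ _
  have hpc : ∀ n : ℕ, (n : ℕ∞) ≤ N → ∀ c, IsChainTo G ρ n c → ∀ k ≤ n,
      P {ω | c k ∈ targetPercolation G ρ B (fun τ => X τ ω)} = p k := fun n hn c hc k hk =>
    hc.measure_mem_targetPercolation hT hX hXm hν hB hk (hle hn k hk)
  have hp1 : ∀ k, p k ≠ ⊤ := fun k => measure_ne_top _ _
  -- If `p k = 0`, a union bound over the finite level `k` would rule out survival.
  have hp0 : ∀ k : ℕ, (k : ℕ∞) ≤ N → p k ≠ 0 := by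
    intro k hk h0
    refine hpos.ne' (le_antisymm ((hsub k hk).trans ?_) bot_le)
    have hnull : P (⋃ σ ∈ {σ | level G ρ σ = k},
        {ω | σ ∈ targetPercolation G ρ B (fun τ => X τ ω)}) = 0 := by
      refine (measure_biUnion_null_iff
        (finite_setOf_level_eq hT hG.locallyFinite k).countable).2 fun σ hσ => ?_
      obtain ⟨c, hc, rfl⟩ := exists_isChainTo hT k σ hσ
      rw [hpc k hk c hc k le_rfl, h0]
    refine (measure_mono ?_).trans hnull.le
    rintro ω ⟨c, hc, hcW⟩
    exact Set.mem_biUnion (x := c k) (hc.level le_rfl) (hcW k le_rfl)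
  have hpanti : ∀ n : ℕ, (n : ℕ∞) ≤ N → ∀ k < n, p (k + 1) ≤ p k := by
    intro n hn k hk
    obtain ⟨c, hc⟩ := hchain n hn
    rw [← hpc n hn c hc k hk.le, ← hpc n hn c hc (k + 1) hk]
    exact measure_mono fun ω hω => hc.mem_targetPercolation_of_le hT (Nat.le_succ k) hk hω
  obtain ⟨μ, hμp, hμ⟩ := exists_uniform_measure_boundary (N := N) hT hf hf1
  -- Survival implies reaching level `n`, so `Q ≤ 2 / E n`, that is `E n ≤ 2 / Q`, uniformly in `n`.
  have henergy : energy p μ ≤ 2 / Q := by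
    refine (energy_le hT hμ p).trans (add_tsum_le_of_forall_sum_le fun n hn => ?_)
    rw [add_sum_eq_ofReal (hf1' n hn) (fun k hk => hp0 k (hle hn k hk)) hp1 (hpanti n hn)]
    obtain ⟨hE, hbound⟩ := measure_exists_chain_le (B := B) (p := fun k => (p k).toReal) hT
      hG.locallyFinite hf hX hXm hν (hf1' n hn) (fun k _ => (ENNReal.ofReal_toReal (hp1 k)).symm)
      (fun k hk => ENNReal.toReal_pos (hp0 k (hle hn k hk)) (hp1 k))
    rw [ENNReal.le_div_iff_mul_le (.inl hpos.ne') (.inl (measure_ne_top _ _))]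
    refine (mul_le_mul_right ((hsub n hn).trans hbound) _).trans ?_
    rw [← ENNReal.ofReal_mul hE.le, mul_div_cancel₀ _ hE.ne']
    simp
  have htop : (2 : ℝ≥0∞) / Q ≠ ⊤ := ENNReal.div_ne_top (by simp) hpos.ne'
  exact ENNReal.inv_pos.2 (ne_top_of_le_ne_top htop (iInf₂_le_of_le μ hμp henergy))

end TreePercolation

theorem mainTheorem9 {V : Type*} (G : SimpleGraph V) (ρ : V) (N : ℕ∞)
    (hG : TreePercolation.IsRootedTree G ρ N)
    (hsym : TreePercolation.IsSphericallySymmetric G ρ)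
    {Ω : Type*} [MeasurableSpace Ω] (P : Measure Ω) [IsProbabilityMeasure P]
    (X : V → Ω → ℝ)
    (hmeas : ∀ σ, σ ≠ ρ → Measurable (X σ))
    (hindep : iIndepFun (fun σ : {σ : V // σ ≠ ρ} => X σ) P)
    (hident : ∀ σ τ, σ ≠ ρ → τ ≠ ρ → IdentDistrib (X σ) (X τ) P P)
    (B : Set ({j : ℕ // (j : ℕ∞) < N} → ℝ)) (hB : IsClosed B) :
    ∃ p : ℕ → ℝ≥0∞,
      (∀ σ, P {ω | TreePercolation.ConnectsTo G ρ
          (TreePercolation.targetPercolation G ρ B (fun τ => X τ ω)) σ} =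
        p (TreePercolation.level G ρ σ)) ∧
      (0 < P {ω | TreePercolation.ReachesBoundary G ρ N
          (TreePercolation.targetPercolation G ρ B (fun τ => X τ ω))} →
        0 < TreePercolation.capacity G ρ N p) := by
  open TreePercolation in
  obtain ⟨f, hf⟩ := hsym
  have hT := hG.isTree
  obtain ⟨ν, hνp, hν⟩ : ∃ ν : Measure ℝ, IsProbabilityMeasure ν ∧
      ∀ σ, σ ≠ ρ → P.map (X σ) = ν := by
    by_cases h : ∃ σ, σ ≠ ρ
    · obtain ⟨σ, hσ⟩ := h
      exact ⟨P.map (X σ), Measure.isProbabilityMeasure_map (hmeas σ hσ).aemeasurable,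
        fun τ hτ => (hident τ σ hτ hσ).map_eq⟩
    -- The tree is a single vertex; any probability measure serves as the label law.
    · exact ⟨Measure.dirac 0, inferInstance, fun σ hσ => absurd ⟨σ, hσ⟩ h⟩
  refine ⟨fun k => Measure.pi (fun _ : Finset.range k => ν) (initialProj B k), fun σ => ?_,
    fun hpos => capacity_pos_of_measure_reachesBoundary_pos hG hf hmeas hindep hν hB hpos⟩
  obtain ⟨c, hc, hcσ⟩ := exists_isChainTo hT _ σ rfl
  refine Eq.trans ?_
    (hc.measure_mem_targetPercolation hT hindep hmeas hν hB le_rfl (hG.level_le σ))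
  congr 1
  ext ω
  have := hc.connectsTo_iff hT B (fun τ => X τ ω) le_rfl
  rw [hcσ] at this ⊢
  exact this
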